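/- **Setting.** Let $X$ be a separable metric space with Borel $\sigma$-algebra $\mathcal B(X)$ and let $\phi=\{\phi_t\}_{t\in\mathbb R}$ be a continuous flow on $X$, i.e. $(t,x)\mapsto\phi_t(x)$ is continuous on $\mathbb R\times X$, $\phi_0(x)=x$ and $\phi_s(\phi_t(x))=\phi_{t+s}(x)$. Let $E^0\subset X$ be a Borel set which is open along the flow: for every $x\in X$ the set $\{t\in\mathbb R:\phi_t(x)\in E^0\}$ is open in $\mathbb R$. Define $$\Gamma^{\pm}=\{z\in\overline{E^0}\setminus E^0:\ z=\phi_{\pm t}(x)\text{ for some }x\in E^0,\ t>0,\text{ with }\phi_{\pm s}(x)\in E^0\text{ for all }s\in[0,t)\},$$ $$E=E^0\cup\Gamma^-\setminus(\Gamma^-\cap\Gamma^+),$$ and, with $\inf\emptyset=\infty$, $$t_{\pm}(x)=\inf\{t>0:\phi_{\pm t}(x)\in\Gamma^{\pm}\}\quad\text{for }x\in E^0\cup\Gamma^{\mp},\qquad t_\pm(x)=0\quad\text{for }x\in\Gamma^\pm\setminus\Gamma^\mp .$$ The sets $\Gamma^\pm$ and the functions $t_\pm\colon E^0\cup\Gamma^\mp\to[0,\infty]$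 are assumed to be Borel. Put $$E_\pm=\{x\in E:0<t_\pm(x)<\infty\},\quad W_\pm=\{(s,z):0<s<t_\mp(z),\ z\in\Gamma^\pm\},\quad w_\pm(x)=(t_\pm(x),\phi_{\pm t_\pm(x)}(x))\ \ (x\in E_\pm).$$ **Assumptions.** 1. There are a jointly measurable function $(t,x)\mapsto J_t(x)\in[0,\infty)$ on $\mathbb R\times X$ with $J_0(x)=1$ and $J_{t+s}(x)=J_t(\phi_s(x))J_s(x)$ for all $s,t\in\mathbb R$, $x\in X$, and a $\sigma$-finite Radon measure $m$ on $\mathcal B(X)$ (locally finite, and inner regular with respect to compact sets on all Borel sets) with $m(\partial E)=0$ and $$m(\phi_t^{-1}(F))=\int_F J_{-t}(x)\,m(dx),\qquad t\in\mathbb R,\ F\in\mathcal B(X).$$ 2. $m^+$ and $m^-$ are finite Borel measures on $\Gamma^+$ and $\Gamma^-$ such that $$m(\{x\in E_\pm: w_\pm(x)\in F\})=\int_{\Gamma^\pm}\int_{\mathbb R}\mathbf 1_F(s,z)\,J_{\mp s}(z)\,ds\,m^\pm(dz)\qquad\text{for all Borel }F\subset W_\pm .$$ **Maximal transport operator.**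 Let $\mathfrak N$ be the set of bounded measurable functions $\psi\colon E\to\mathbb R$ with compact support in $E^0$ (that is, vanishing off some compact subset of $E^0$; they are extended by $0$ to $X$) such that for every $x\in E$ the function $t\mapsto\psi(\phi_t(x))$ is continuously differentiable on $(-t_-(x),t_+(x))$, and $D\psi(x)=\frac{d}{dt}\psi(\phi_t(x))\big|_{t=0}$ is bounded and measurable. A function $f\in L^1(E,m)$ belongs to $\mathcal D_{\max}$, and $\mathrm T_{\max}f=g$, if $g\in L^1(E,m)$ and $$\int_E g\,\psi\,dm=\int_E f\,D\psi\,dm\qquad\text{for all }\psi\in\mathfrak N .$$ **Traces.** For (the $m$-class of) $f\in L^1(E,m)$ the traces are the pointwise limits $$\gamma^\pm f(z)=\lim_{s\to0^+}f(\phi_{\mp s}(z))J_{\mp s}(z),\qquad z\in\Gamma^\pm,$$ provided that, for a suitable representative of $f$, these limits exist for $m^\pm$-a.e. $z$. **Theorem.** Let $f\in\mathcal D_{\max}$. Then the traces $\gamma^-f$ and $\gamma^+f$ exist. If $\gamma^-f\in L^1(\Gamma^-,m^-)$, then $\gamma^+f\in L^1(\Gamma^+,m^+)$ and $$\int_E\mathrm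 T_{\max}f\,dm=\int_{\Gamma^-}\gamma^-f\,dm^--\int_{\Gamma^+}\gamma^+f\,dm^+ .$$ -/

import Mathlib

open MeasureTheory Filter Topology Set

namespace FlowTransport

noncomputable section

section Geometry

variable {X : Type*} [TopologicalSpace X] (φ : Flow ℝ X) (E0 : Set X)

/-- The outgoing boundary `Γ⁺`: points of `closure E0 \ E0` through which the flow leaves `E0`. -/
def outBd : Set X :=
  {z | z ∈ closure E0 \ E0 ∧ ∃ x ∈ E0, ∃ t : ℝ, 0 < t ∧ z = φ t x ∧
    ∀ s ∈ Ico 0 t, φ s x ∈ E0}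

/-- The incoming boundary `Γ⁻`: points of `closure E0 \ E0` through which the flow enters `E0`. -/
def inBd : Set X :=
  {z | z ∈ closure E0 \ E0 ∧ ∃ x ∈ E0, ∃ t : ℝ, 0 < t ∧ z = φ (-t) x ∧
    ∀ s ∈ Ico 0 t, φ (-s) x ∈ E0}

/-- The state space `E = E0 ∪ Γ⁻ \ (Γ⁻ ∩ Γ⁺)`; recall that `E0` is disjoint from `Γ⁻` and `Γ⁺`. -/
def stateSp : Set X :=
  E0 ∪ (inBd φ E0 \ (inBd φ E0 ∩ outBd φ E0))

open Classical in
/-- The hitting time `t₊ ∈ [0, ∞]` of `Γ⁺`, with `inf ∅ = ∞`. It is given by the infimum at the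
points of `E0` and of `Γ⁻`, and it is `0` at the remaining points of `Γ⁺`. -/
def tPlus (x : X) : EReal :=
  if x ∈ outBd φ E0 \ inBd φ E0 then 0
  else sInf ((fun t : ℝ => (t : EReal)) '' {t : ℝ | 0 < t ∧ φ t x ∈ outBd φ E0})

open Classical in
/-- The backward hitting time `t₋ ∈ [0, ∞]` of `Γ⁻`, with `inf ∅ = ∞`. It is given by the infimum
at the points of `E0` and of `Γ⁺`, and it is `0` at the remaining points of `Γ⁻`. -/
def tMinus (x : X) : EReal :=
  if x ∈ inBd φ E0 \ outBd φ E0 then 0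
  else sInf ((fun t : ℝ => (t : EReal)) '' {t : ℝ | 0 < t ∧ φ (-t) x ∈ inBd φ E0})

/-- `E₊ = {x ∈ E : 0 < t₊(x) < ∞}`. -/
def EPlus : Set X := {x | x ∈ stateSp φ E0 ∧ 0 < tPlus φ E0 x ∧ tPlus φ E0 x < ⊤}

/-- `E₋ = {x ∈ E : 0 < t₋(x) < ∞}`. -/
def EMinus : Set X := {x | x ∈ stateSp φ E0 ∧ 0 < tMinus φ E0 x ∧ tMinus φ E0 x < ⊤}

/-- `W₊ = {(s, z) : 0 < s < t₋(z), z ∈ Γ⁺}`. -/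
def WPlus : Set (ℝ × X) :=
  {p | 0 < p.1 ∧ (p.1 : EReal) < tMinus φ E0 p.2 ∧ p.2 ∈ outBd φ E0}

/-- `W₋ = {(s, z) : 0 < s < t₊(z), z ∈ Γ⁻}`. -/
def WMinus : Set (ℝ × X) :=
  {p | 0 < p.1 ∧ (p.1 : EReal) < tPlus φ E0 p.2 ∧ p.2 ∈ inBd φ E0}

/-- `w₊(x) = (t₊(x), φ_{t₊(x)}(x))`, of interest on `E₊`. -/
def wPlus (x : X) : ℝ × X := ((tPlus φ E0 x).toReal, φ (tPlus φ E0 x).toReal x)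

/-- `w₋(x) = (t₋(x), φ_{-t₋(x)}(x))`, of interest on `E₋`. -/
def wMinus (x : X) : ℝ × X := ((tMinus φ E0 x).toReal, φ (-(tMinus φ E0 x).toReal) x)

/-- The derivative along the flow, `d(ψ ∘ φ_t)/dt` at `t = 0`. -/
def flowDeriv (ψ : X → ℝ) (x : X) : ℝ := deriv (fun t : ℝ => ψ (φ t x)) 0

end Geometry

section Measures

variable {X : Type*} [TopologicalSpace X] [MeasurableSpace X] (φ : Flow ℝ X) (E0 : Set X)

/-- The measurability that makes the objects below meaningful: `E0`, `Γ⁺`, `Γ⁻` are Borel sets and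
`t₊`, `t₋` are Borel functions where they are given by the infimum. -/
structure BorelGeometry : Prop where
  measurableSet_E0 : MeasurableSet E0
  measurableSet_outBd : MeasurableSet (outBd φ E0)
  measurableSet_inBd : MeasurableSet (inBd φ E0)
  measurable_tPlus : Measurable ((E0 ∪ inBd φ E0).domRestrict (tPlus φ E0))
  measurable_tMinus : Measurable ((E0 ∪ outBd φ E0).domRestrict (tMinus φ E0))

/-- `J` is a (jointly) measurable nonnegative cocycle of the flow. -/
structure IsCocycle (J : ℝ → X → ℝ) : Prop where
  measurable : Measurable (fun p : ℝ × X => J p.1 p.2)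
  nonneg : ∀ t x, 0 ≤ J t x
  zero : ∀ x, J 0 x = 1
  add : ∀ s t x, J (t + s) x = J t (φ s x) * J s x

/-- The flow is non-singular with respect to `m`, with densities given by the cocycle `J`:
`m(φ_t⁻¹(F)) = ∫_F J_{-t} dm`. -/
def HasFlowDensity (J : ℝ → X → ℝ) (m : Measure X) : Prop :=
  ∀ (t : ℝ) (F : Set X), MeasurableSet F →
    m ((fun x => φ t x) ⁻¹' F) = ∫⁻ x in F, ENNReal.ofReal (J (-t) x) ∂m

/-- `mp` is a measure on `Γ⁺` with `(m ∘ w₊⁻¹)(F) = ∫_F J_{-s}(z) ds mp(dz)` for all Borel subsets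
`F` of `W₊`. A Borel measure on `Γ⁺` is seen as a measure on `X` that is concentrated on `Γ⁺`. -/
structure IsOutMeasure (J : ℝ → X → ℝ) (m mp : Measure X) : Prop where
  concentrated : mp (outBd φ E0)ᶜ = 0
  map_eq : ∀ F : Set (ℝ × X), MeasurableSet F → F ⊆ WPlus φ E0 →
    m {x | x ∈ EPlus φ E0 ∧ wPlus φ E0 x ∈ F} =
      ∫⁻ z, (∫⁻ s : ℝ, F.indicator (fun p => ENNReal.ofReal (J (-p.1) p.2)) (s, z)) ∂mp

/-- `mm` is a measure on `Γ⁻` with `(m ∘ w₋⁻¹)(F) = ∫_F J_s(z) ds mm(dz)` for all Borel subsets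
`F` of `W₋`. -/
structure IsInMeasure (J : ℝ → X → ℝ) (m mm : Measure X) : Prop where
  concentrated : mm (inBd φ E0)ᶜ = 0
  map_eq : ∀ F : Set (ℝ × X), MeasurableSet F → F ⊆ WMinus φ E0 →
    m {x | x ∈ EMinus φ E0 ∧ wMinus φ E0 x ∈ F} =
      ∫⁻ z, (∫⁻ s : ℝ, F.indicator (fun p => ENNReal.ofReal (J p.1 p.2)) (s, z)) ∂mm

/-- The test functions: bounded measurable functions with compact support in `E0` (extended by `0`
to the whole space), continuously differentiable along the flow, with bounded measurable derivative
along the flow. (Off its support, in particular off `E0`, such a function has `flowDeriv = 0`.) -/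
structure IsTestFun (ψ : X → ℝ) : Prop where
  measurable : Measurable ψ
  bounded : ∃ C : ℝ, ∀ x, |ψ x| ≤ C
  compact_support : ∃ K : Set X, IsCompact K ∧ K ⊆ E0 ∧ ∀ x, x ∉ K → ψ x = 0
  contDiff : ∀ x ∈ stateSp φ E0, ContDiffOn ℝ 1 (fun t : ℝ => ψ (φ t x))
    {t : ℝ | -(tMinus φ E0 x) < (t : EReal) ∧ (t : EReal) < tPlus φ E0 x}
  measurable_deriv : Measurable (flowDeriv φ ψ)
  bounded_deriv : ∃ C : ℝ, ∀ x, |flowDeriv φ ψ x| ≤ C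

/-- The graph of the maximal transport operator on `L¹(E, m)`: `f` lies in its domain `D_max` and
`g` is (a version of) `T_max f`. -/
structure IsTmax (m : Measure X) (f g : X → ℝ) : Prop where
  integrable_left : IntegrableOn f (stateSp φ E0) m
  integrable_right : IntegrableOn g (stateSp φ E0) m
  weak : ∀ ψ : X → ℝ, IsTestFun φ E0 ψ →
    ∫ x in stateSp φ E0, g x * ψ x ∂m = ∫ x in stateSp φ E0, f x * flowDeriv φ ψ x ∂m

/-- `h` is (a version of) the trace `γ⁺ f` of the `m`-class of `f` on `Γ⁺`: the limits
`lim_{s → 0+} f(φ_{-s}(z)) J_{-s}(z)` exist, for a suitable representative of `f`, and equal `h z`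
for `mp`-almost every `z`. -/
def IsOutTrace (J : ℝ → X → ℝ) (m mp : Measure X) (f h : X → ℝ) : Prop :=
  ∃ f' : X → ℝ, f' =ᵐ[m.restrict (stateSp φ E0)] f ∧
    ∀ᵐ z ∂mp, Tendsto (fun s : ℝ => f' (φ (-s) z) * J (-s) z) (𝓝[>] 0) (𝓝 (h z))

/-- `h` is (a version of) the trace `γ⁻ f` of the `m`-class of `f` on `Γ⁻`: the limits
`lim_{s → 0+} f(φ_s(z)) J_s(z)` exist, for a suitable representative of `f`, and equal `h z`
for `mm`-almost every `z`. -/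
def IsInTrace (J : ℝ → X → ℝ) (m mm : Measure X) (f h : X → ℝ) : Prop :=
  ∃ f' : X → ℝ, f' =ᵐ[m.restrict (stateSp φ E0)] f ∧
    ∀ᵐ z ∂mm, Tendsto (fun s : ℝ => f' (φ s z) * J s z) (𝓝[>] 0) (𝓝 (h z))

end Measures

end

end FlowTransport

open FlowTransport

/-! Put `alongFlow φ J u y t = u(φ_t y) J_t(y)`. The heart of the matter is that the weak equation
means that, for a good representative of `f`, the function `t ↦ alongFlow φ J f y t` is on almost
every orbit a primitive of `-alongFlow φ J g y t` as long as the orbit stays in `E0`, where `g` is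
`T_max f`. Traces are then end values of primitives, and Green's formula is the fundamental theorem
of calculus integrated over all orbits.

To reach the orbits, the weak equation is tested with `averagedTestFun`, a time average of the
indicator of a compact `K` with a tent-shaped kernel. It is C¹ along the flow however rough the
indicator is. By Fubini and the change of variables under the flow the averages move onto `f` and
`g`. As `K` is arbitrary, this gives `ae_balance_add`: the function `balance` of the time `u` is
additive for almost every `y`. Being continuous, it is linear, and differentiating it gives the
equation for `regularize φ J f`, the limit of backward averages (`ae_solvesAlong_regularize`).

The hypotheses on `m⁺` and `m⁻` say that `m` disintegrates over the orbits ending on `Γ⁺` or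
starting on `Γ⁻` (`Disintegrates`). Hence almost every boundary orbit carries a primitive of an
integrable function, and its limit at the boundary exists. For Green's formula `E0` is cut by the
fate of the orbits. On an orbit ending on `Γ⁺` of infinite backward lifetime, an integrable
primitive must vanish at infinity, so `γ⁺f` is minus the integral of `g`; likewise `γ⁻f` is the
integral of `g` on an orbit of infinite forward lifetime. On a chord from `Γ⁻` to `Γ⁺` the traces
differ by the integral of `g` (`ae_trace_exit_eq`), and `m⁺` is the image of `m⁻` with density `J`
under the exit map (`restrict_finiteOut_eq_map`). Orbits that never leave `E0` form an invariant
set, over which `g` has integral zero (`setIntegral_eq_zero_of_invariant`).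

Statements about `Γ⁻` follow from those about `Γ⁺` by passing to `φ.reverse`, the cocycle `t ↦ J
(-t)` and the source `-g`. -/

namespace FlowTransport

/-! ### Boundary points, hitting times and time reversal. -/

section Geometry

variable {X : Type*} [TopologicalSpace X] (φ : Flow ℝ X) (E0 : Set X)

theorem flow_neg_flow (t : ℝ) (x : X) : φ (-t) (φ t x) = x := by
  rw [← φ.map_add]; simp

theorem flow_flow_neg (t : ℝ) (x : X) : φ t (φ (-t) x) = x := by
  rw [← φ.map_add]; simp

/-- This and the next three identities are the dictionary through which results on the outgoing
boundary are reused for the incoming one. -/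
theorem outBd_reverse : outBd φ.reverse E0 = inBd φ E0 := rfl

theorem inBd_reverse : inBd φ.reverse E0 = outBd φ E0 := by
  simp [inBd, outBd, Flow.reverse_apply]

theorem tPlus_reverse : tPlus φ.reverse E0 = tMinus φ E0 := by
  funext x
  simp only [tPlus, tMinus, outBd_reverse, Flow.reverse_apply]
  congr 2
  rw [inBd_reverse]

theorem tMinus_reverse : tMinus φ.reverse E0 = tPlus φ E0 := by
  funext x
  simp only [tPlus, tMinus, outBd_reverse, inBd_reverse, Flow.reverse_apply, neg_neg]
  congr 2
  rw [inBd_reverse]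

theorem isOpen_orbit_reverse {φ : Flow ℝ X} {E0 : Set X}
    (hE0 : ∀ x : X, IsOpen {t : ℝ | φ t x ∈ E0}) (x : X) :
    IsOpen {t : ℝ | φ.reverse t x ∈ E0} :=
  (hE0 x).preimage continuous_neg

variable {φ E0}

theorem notMem_of_mem_outBd {z : X} (hz : z ∈ outBd φ E0) : z ∉ E0 := hz.1.2

theorem notMem_of_mem_inBd {z : X} (hz : z ∈ inBd φ E0) : z ∉ E0 := hz.1.2

theorem exists_forall_mem_of_mem_inBd {z : X} (hz : z ∈ inBd φ E0) :
    ∃ ε : ℝ, 0 < ε ∧ ∀ s ∈ Ioc 0 ε, φ s z ∈ E0 := by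
  obtain ⟨-, x, hx, t, ht, rfl, h⟩ := hz
  refine ⟨t, ht, fun s hs => ?_⟩
  have := h (t - s) ⟨by linarith [hs.2], by linarith [hs.1]⟩
  rwa [← φ.map_add, show s + -t = -(t - s) by ring]

theorem exists_forall_mem (hE0 : ∀ x : X, IsOpen {t : ℝ | φ t x ∈ E0}) {x : X}
    (hx : x ∈ E0 ∪ inBd φ E0) : ∃ ε : ℝ, 0 < ε ∧ ∀ s ∈ Ioc 0 ε, φ s x ∈ E0 := by
  rcases hx with hx | hx
  · have h0 : (0 : ℝ) ∈ {t : ℝ | φ t x ∈ E0} := by simpa using hx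
    obtain ⟨ε, hε, h⟩ := Metric.isOpen_iff.1 (hE0 x) 0 h0
    refine ⟨ε / 2, by positivity, fun s hs => h ?_⟩
    rw [Metric.mem_ball, Real.dist_eq, sub_zero, abs_of_pos hs.1]
    linarith [hs.2]
  · exact exists_forall_mem_of_mem_inBd hx

theorem tPlus_eq_sInf {x : X} (hx : x ∈ E0 ∪ inBd φ E0) :
    tPlus φ E0 x =
      sInf ((fun t : ℝ => (t : EReal)) '' {t : ℝ | 0 < t ∧ φ t x ∈ outBd φ E0}) := by
  rw [tPlus, if_neg]
  rintro ⟨h1, h2⟩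
  rcases hx with hx | hx
  · exact notMem_of_mem_outBd h1 hx
  · exact h2 hx

theorem tPlus_le {x : X} (hx : x ∈ E0 ∪ inBd φ E0) {r : ℝ} (hr : 0 < r)
    (h : φ r x ∈ outBd φ E0) : tPlus φ E0 x ≤ r := by
  rw [tPlus_eq_sInf hx]
  exact sInf_le ⟨r, ⟨hr, h⟩, rfl⟩

theorem le_tPlus {x : X} (hx : x ∈ E0 ∪ inBd φ E0) {r : ℝ}
    (h : ∀ s ∈ Ioo 0 r, φ s x ∈ E0) : (r : EReal) ≤ tPlus φ E0 x := by
  rw [tPlus_eq_sInf hx]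
  refine le_sInf ?_
  rintro _ ⟨t, ⟨ht, hout⟩, rfl⟩
  simp only [EReal.coe_le_coe_iff]
  by_contra! hlt
  exact notMem_of_mem_outBd hout (h t ⟨ht, hlt⟩)

/-- The first exit from `E0` is through the outgoing boundary. -/
theorem exists_mem_outBd (hE0 : ∀ x : X, IsOpen {t : ℝ | φ t x ∈ E0}) {x : X}
    (hx : x ∈ E0 ∪ inBd φ E0) {s : ℝ} (hs : 0 < s) (hsx : φ s x ∉ E0) :
    ∃ b : ℝ, 0 < b ∧ b ≤ s ∧ φ b x ∈ outBd φ E0 ∧ ∀ r ∈ Ioo 0 b, φ r x ∈ E0 := by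
  obtain ⟨ε, hε, hεx⟩ := exists_forall_mem hE0 hx
  have hεs : ε < s := by
    by_contra! h
    exact hsx (hεx s ⟨hs, h⟩)
  -- Starting at `ε` rather than `0` keeps the first exit time positive: `x` itself lies outside
  -- `E0` when it is on `Γ⁻`.
  set B : Set ℝ := Icc ε s ∩ {t : ℝ | φ t x ∈ E0}ᶜ with hB
  have hBc : IsClosed B := isClosed_Icc.inter (hE0 x).isClosed_compl
  have hBne : B.Nonempty := ⟨s, ⟨hεs.le, le_rfl⟩, hsx⟩
  have hBb : BddBelow B := ⟨ε, fun t ht => ht.1.1⟩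
  have hmem : sInf B ∈ B := hBc.csInf_mem hBne hBb
  set b := sInf B with hb
  have hb0 : 0 < b := hε.trans_le hmem.1.1
  have hlt : ∀ r ∈ Ioo 0 b, φ r x ∈ E0 := by
    intro r hr
    by_contra hrx
    rcases le_or_gt r ε with h | h
    · exact hrx (hεx r ⟨hr.1, h⟩)
    · exact absurd (csInf_le hBb ⟨⟨h.le, hr.2.le.trans hmem.1.2⟩, hrx⟩) (not_le.2 hr.2)
  refine ⟨b, hb0, hmem.1.2, ⟨⟨?_, hmem.2⟩, φ (b / 2) x, hlt _ ⟨by linarith, by linarith⟩, b / 2,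
    by linarith, ?_, ?_⟩, hlt⟩
  · have hc : Tendsto (fun t : ℝ => φ t x) (𝓝[<] b) (𝓝 (φ b x)) :=
      ((φ.continuous continuous_id continuous_const).tendsto b).mono_left nhdsWithin_le_nhds
    refine mem_closure_of_tendsto hc ?_
    filter_upwards [Ioo_mem_nhdsLT hb0] with t ht using hlt t ht
  · rw [← φ.map_add]; ring_nf
  · intro t ht
    rw [← φ.map_add]
    exact hlt _ ⟨by linarith [ht.1], by linarith [ht.2]⟩

theorem flow_mem_of_lt_tPlus (hE0 : ∀ x : X, IsOpen {t : ℝ | φ t x ∈ E0}) {x : X}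
    (hx : x ∈ E0 ∪ inBd φ E0) {s : ℝ} (hs : 0 < s) (h : (s : EReal) < tPlus φ E0 x) :
    φ s x ∈ E0 := by
  by_contra hsx
  obtain ⟨b, hb, hbs, hout, -⟩ := exists_mem_outBd hE0 hx hs hsx
  exact absurd (h.trans_le (tPlus_le hx hb hout)) (not_lt.2 (by exact_mod_cast hbs))

/-- Openness along the flow keeps the orbit in `E0` slightly beyond `r`, which makes the inequality
strict although `r` itself is included on the right. -/
theorem coe_lt_tPlus_iff (hE0 : ∀ x : X, IsOpen {t : ℝ | φ t x ∈ E0}) {x : X}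
    (hx : x ∈ E0 ∪ inBd φ E0) {r : ℝ} (hr : 0 < r) :
    (r : EReal) < tPlus φ E0 x ↔ ∀ s ∈ Ioc 0 r, φ s x ∈ E0 := by
  refine ⟨fun h s hs => flow_mem_of_lt_tPlus hE0 hx hs.1
    (lt_of_le_of_lt (by exact_mod_cast hs.2) h), fun h => ?_⟩
  have hE : r ∈ {t : ℝ | φ t x ∈ E0} := h r ⟨hr, le_rfl⟩
  obtain ⟨ε, hε, hball⟩ := Metric.isOpen_iff.1 (hE0 x) r hE
  refine lt_of_lt_of_le (b := ((r + ε : ℝ) : EReal)) (by exact_mod_cast (by linarith)) ?_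
  refine le_tPlus hx fun s hs => ?_
  rcases le_or_gt s r with hsr | hsr
  · exact h s ⟨hs.1, hsr⟩
  · refine hball ?_
    rw [Metric.mem_ball, Real.dist_eq, abs_of_pos (by linarith)]
    linarith [hs.2]

theorem tPlus_pos (hE0 : ∀ x : X, IsOpen {t : ℝ | φ t x ∈ E0}) {x : X}
    (hx : x ∈ E0 ∪ inBd φ E0) : 0 < tPlus φ E0 x := by
  obtain ⟨ε, hε, h⟩ := exists_forall_mem hE0 hx
  exact lt_of_lt_of_le (by exact_mod_cast hε) (le_tPlus hx fun s hs => h s ⟨hs.1, hs.2.le⟩)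

theorem coe_toReal_tPlus (hE0 : ∀ x : X, IsOpen {t : ℝ | φ t x ∈ E0}) {x : X}
    (hx : x ∈ E0 ∪ inBd φ E0) (h : tPlus φ E0 x < ⊤) :
    ((tPlus φ E0 x).toReal : EReal) = tPlus φ E0 x :=
  EReal.coe_toReal h.ne (ne_bot_of_gt (tPlus_pos hE0 hx))

theorem toReal_tPlus_pos (hE0 : ∀ x : X, IsOpen {t : ℝ | φ t x ∈ E0}) {x : X}
    (hx : x ∈ E0 ∪ inBd φ E0) (h : tPlus φ E0 x < ⊤) : 0 < (tPlus φ E0 x).toReal := by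
  have := tPlus_pos hE0 hx
  rw [← coe_toReal_tPlus hE0 hx h] at this
  exact_mod_cast this

/-- The infimum is attained: if the orbit were still in `E0` at that time, openness would delay the
hitting time; so a first exit occurs by then, and it cannot occur earlier. -/
theorem flow_toReal_tPlus_mem_outBd (hE0 : ∀ x : X, IsOpen {t : ℝ | φ t x ∈ E0}) {x : X}
    (hx : x ∈ E0 ∪ inBd φ E0) (h : tPlus φ E0 x < ⊤) :
    φ (tPlus φ E0 x).toReal x ∈ outBd φ E0 := by
  have hc := coe_toReal_tPlus hE0 hx h
  have hpos := toReal_tPlus_pos hE0 hx h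
  set b := (tPlus φ E0 x).toReal
  have hnot : φ b x ∉ E0 := by
    intro hb
    refine absurd hc (ne_of_lt ((coe_lt_tPlus_iff hE0 hx hpos).2 fun s hs => ?_))
    rcases hs.2.eq_or_lt with rfl | hlt
    · exact hb
    · exact flow_mem_of_lt_tPlus hE0 hx hs.1 (by rw [← hc]; exact_mod_cast hlt)
  obtain ⟨c, hc0, hcb, hout, -⟩ := exists_mem_outBd hE0 hx hpos hnot
  have : b ≤ c := by
    have := tPlus_le hx hc0 hout
    rw [← hc] at this
    exact_mod_cast this
  rwa [le_antisymm this hcb]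

theorem tPlus_eq_coe {x : X} (hx : x ∈ E0 ∪ inBd φ E0) {s : ℝ} (hs : 0 < s)
    (h : ∀ r ∈ Ioo 0 s, φ r x ∈ E0) (hout : φ s x ∈ outBd φ E0) : tPlus φ E0 x = s :=
  le_antisymm (tPlus_le hx hs hout) (le_tPlus hx h)

theorem subset_stateSp : E0 ⊆ stateSp φ E0 := subset_union_left

/-- Every orbit meets the incoming boundary in a countable set of times. -/
theorem countable_orbit_inBd (x : X) : {t : ℝ | φ t x ∈ inBd φ E0}.Countable := by
  refine (countable_setOfPred_isolated_right_within
    (s := {t : ℝ | φ t x ∈ inBd φ E0})).mono ?_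
  intro t ht
  refine ⟨ht, ?_⟩
  obtain ⟨ε, hε, h⟩ := exists_forall_mem_of_mem_inBd ht
  rw [← empty_mem_iff_bot, mem_nhdsWithin]
  refine ⟨Iio (t + ε), isOpen_Iio, by simpa using hε, ?_⟩
  rintro r ⟨hr, hrin, htr⟩
  refine notMem_of_mem_inBd hrin ?_
  have := h (r - t) ⟨sub_pos.2 htr, by linarith [mem_Iio.1 hr]⟩
  rwa [← φ.map_add, sub_add_cancel] at this

end Geometry

/-! ### Borel versions of the hitting times. -/

section MeasurableGeometry

variable {X : Type*} [TopologicalSpace X] [MeasurableSpace X] {φ : Flow ℝ X} {E0 : Set X}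

theorem BorelGeometry.reverse (h : BorelGeometry φ E0) : BorelGeometry φ.reverse E0 where
  measurableSet_E0 := h.measurableSet_E0
  measurableSet_outBd := h.measurableSet_inBd
  measurableSet_inBd := by rw [inBd_reverse]; exact h.measurableSet_outBd
  measurable_tPlus := by rw [tPlus_reverse, inBd_reverse]; exact h.measurable_tMinus
  measurable_tMinus := by rw [tMinus_reverse, outBd_reverse]; exact h.measurable_tPlus

/-- A Borel function on the whole space which agrees with `tPlus` on `E0` and on the incoming
boundary. -/
theorem BorelGeometry.exists_measurable_tPlus (h : BorelGeometry φ E0) :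
    ∃ T : X → EReal, Measurable T ∧ ∀ x ∈ E0 ∪ inBd φ E0, T x = tPlus φ E0 x := by
  classical
  refine ⟨fun x => if hx : x ∈ E0 ∪ inBd φ E0 then tPlus φ E0 x else 0, ?_, fun x hx => ?_⟩
  · exact Measurable.dite (s := E0 ∪ inBd φ E0) (f := fun x => tPlus φ E0 x)
      (g := fun _ => 0) h.measurable_tPlus measurable_const
      (h.measurableSet_E0.union h.measurableSet_inBd)
  · simp only [dif_pos hx]

end MeasurableGeometry

/-! ### Densities transported along the flow, and the cocycle. -/

section AlongFlow

variable {X : Type*} [TopologicalSpace X] {φ : Flow ℝ X} {J : ℝ → X → ℝ}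

/-- The density `u`, transported along the orbit of `y`. -/
def alongFlow (φ : Flow ℝ X) (J : ℝ → X → ℝ) (u : X → ℝ) (y : X) (t : ℝ) : ℝ :=
  u (φ t y) * J t y

theorem alongFlow_reverse (u : X → ℝ) (y : X) (t : ℝ) :
    alongFlow φ.reverse (fun t => J (-t)) u y t = alongFlow φ J u y (-t) := rfl

theorem alongFlow_neg (u : X → ℝ) (y : X) (t : ℝ) :
    alongFlow φ J (fun x => -u x) y t = -alongFlow φ J u y t := by
  simp [alongFlow]

end AlongFlow

section Cocycle

variable {X : Type*} [TopologicalSpace X] [MeasurableSpace X] {φ : Flow ℝ X} {J : ℝ → X → ℝ}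

theorem IsCocycle.mul_neg (hJ : IsCocycle φ J) (t : ℝ) (x : X) :
    J (-t) (φ t x) * J t x = 1 := by
  rw [← hJ.add, neg_add_cancel, hJ.zero]

theorem IsCocycle.pos (hJ : IsCocycle φ J) (t : ℝ) (x : X) : 0 < J t x := by
  refine (hJ.nonneg t x).lt_of_ne' fun h => ?_
  have := hJ.mul_neg t x
  simp [h] at this

theorem IsCocycle.reverse (hJ : IsCocycle φ J) : IsCocycle φ.reverse (fun t => J (-t)) where
  measurable := hJ.measurable.comp (measurable_fst.neg.prodMk measurable_snd)
  nonneg t x := hJ.nonneg _ x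
  zero x := by simpa using hJ.zero x
  add s t x := by
    rw [neg_add]
    exact hJ.add (-s) (-t) x

theorem alongFlow_zero (hJ : IsCocycle φ J) (u : X → ℝ) (y : X) : alongFlow φ J u y 0 = u y := by
  simp [alongFlow, hJ.zero]

theorem alongFlow_flow_mul (hJ : IsCocycle φ J) (u : X → ℝ) (y : X) (s t : ℝ) :
    alongFlow φ J u (φ s y) t * J s y = alongFlow φ J u y (t + s) := by
  rw [alongFlow, alongFlow, hJ.add, φ.map_add, mul_assoc]

variable {m : Measure X}

theorem HasFlowDensity.reverse (hm : HasFlowDensity φ J m) :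
    HasFlowDensity φ.reverse (fun t => J (-t)) m :=
  fun t F hF => hm (-t) F hF

theorem IsCocycle.measurable_apply (hJ : IsCocycle φ J) (t : ℝ) : Measurable (J t) :=
  hJ.measurable.comp (measurable_const.prodMk measurable_id)

theorem HasFlowDensity.preimage_null (hm : HasFlowDensity φ J m) (t : ℝ) {N : Set X}
    (hN : m N = 0) : m ((fun x => φ t x) ⁻¹' N) = 0 := by
  refine measure_mono_null (preimage_mono (subset_toMeasurable m N)) ?_
  rw [hm t _ (measurableSet_toMeasurable m N)]
  exact setLIntegral_measure_zero _ _ (by rwa [measure_toMeasurable])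

theorem HasFlowDensity.ae_flow (hm : HasFlowDensity φ J m) (t : ℝ) {p : X → Prop}
    (hp : ∀ᵐ x ∂m, p x) : ∀ᵐ x ∂m, p (φ t x) :=
  hm.preimage_null t hp

end Cocycle

/-! ### Change of variables under the flow. -/

section ChangeOfVariables

variable {X : Type*} [TopologicalSpace X] [MeasurableSpace X] [BorelSpace X]
  {φ : Flow ℝ X} {J : ℝ → X → ℝ} {m : Measure X}

theorem measurable_flow_apply (φ : Flow ℝ X) (t : ℝ) : Measurable (fun x => φ t x) :=
  (φ.continuous_toFun t).measurable

theorem HasFlowDensity.map_flow (hm : HasFlowDensity φ J m) (t : ℝ) :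
    m.map (fun x => φ t x) = m.withDensity (fun x => ENNReal.ofReal (J (-t) x)) := by
  ext F hF
  rw [Measure.map_apply (measurable_flow_apply φ t) hF, hm t F hF, withDensity_apply _ hF]

theorem HasFlowDensity.integrable_comp_iff (hJ : IsCocycle φ J) (hm : HasFlowDensity φ J m)
    (t : ℝ) {k : X → ℝ} (hk : Measurable k) :
    Integrable (fun x => k (φ t x)) m ↔ Integrable (fun x => k x * J (-t) x) m := by
  have h1 := integrable_map_measure (μ := m) (f := fun x => φ t x) (g := k)
    hk.aestronglyMeasurable (measurable_flow_apply φ t).aemeasurable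
  rw [Function.comp_def] at h1
  rw [← h1, hm.map_flow t, integrable_withDensity_iff (hJ.measurable_apply _).ennreal_ofReal
    (by simp)]
  simp [ENNReal.toReal_ofReal (hJ.nonneg _ _)]

theorem HasFlowDensity.integral_comp (hJ : IsCocycle φ J) (hm : HasFlowDensity φ J m)
    (t : ℝ) {k : X → ℝ} (hk : Measurable k) :
    ∫ x, k (φ t x) ∂m = ∫ x, k x * J (-t) x ∂m := by
  rw [← integral_map (μ := m) (φ := fun x => φ t x) (f := k)
    (measurable_flow_apply φ t).aemeasurable hk.aestronglyMeasurable, hm.map_flow t,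
    integral_withDensity_eq_integral_toReal_smul (hJ.measurable_apply _).ennreal_ofReal (by simp)]
  simp [ENNReal.toReal_ofReal (hJ.nonneg _ _), mul_comm]

theorem HasFlowDensity.integrable_alongFlow (hJ : IsCocycle φ J) (hm : HasFlowDensity φ J m)
    (t : ℝ) {u : X → ℝ} (hu : Measurable u) (hui : Integrable u m) :
    Integrable (fun y => alongFlow φ J u y t) m := by
  have := (hm.integrable_comp_iff hJ (-t) (hu.comp (measurable_flow_apply φ t))).1
    (by simpa [flow_flow_neg] using hui)
  simpa [alongFlow] using this

/-- Transport of densities is adjoint to composition with the flow: the substitution `x = φ_t y`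
absorbs the factor `J_t`. -/
theorem HasFlowDensity.integral_alongFlow_mul (hJ : IsCocycle φ J) (hm : HasFlowDensity φ J m)
    (t : ℝ) {u k : X → ℝ} (hu : Measurable u) (hk : Measurable k) :
    ∫ y, alongFlow φ J u y t * k y ∂m = ∫ x, u x * k (φ (-t) x) ∂m := by
  have := hm.integral_comp hJ (-t) ((hu.comp (measurable_flow_apply φ t)).mul hk)
  simp only [Pi.mul_apply, Function.comp_apply, flow_flow_neg, neg_neg] at this
  rw [this]
  refine integral_congr_ae (Eventually.of_forall fun y => ?_)
  simp only [alongFlow]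
  ring

theorem HasFlowDensity.integral_alongFlow (hJ : IsCocycle φ J) (hm : HasFlowDensity φ J m)
    (t : ℝ) {u : X → ℝ} (hu : Measurable u) :
    ∫ y, alongFlow φ J u y t ∂m = ∫ x, u x ∂m := by
  simpa using hm.integral_alongFlow_mul hJ t hu (k := fun _ => 1) measurable_const

end ChangeOfVariables

/-! ### Fubini in time and space, and null sets detected along orbits. -/

section Fubini

variable {X : Type*} [TopologicalSpace X] [SecondCountableTopology X] [MeasurableSpace X]
  [BorelSpace X] {φ : Flow ℝ X} {J : ℝ → X → ℝ} {m : Measure X}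

theorem measurable_flow (φ : Flow ℝ X) : Measurable (fun p : ℝ × X => φ p.1 p.2) :=
  (φ.continuous continuous_fst continuous_snd).measurable

theorem measurable_flow_left (φ : Flow ℝ X) (x : X) : Measurable (fun t : ℝ => φ t x) :=
  (measurable_flow φ).comp (measurable_id.prodMk measurable_const)

theorem measurable_alongFlow (hJ : IsCocycle φ J) {u : X → ℝ} (hu : Measurable u) :
    Measurable (fun p : ℝ × X => alongFlow φ J u p.2 p.1) :=
  (hu.comp (measurable_flow φ)).mul hJ.measurable

theorem HasFlowDensity.integrable_alongFlow_prod [SFinite m] (hJ : IsCocycle φ J)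
    (hm : HasFlowDensity φ J m) {u : X → ℝ} (hu : Measurable u) (hui : Integrable u m)
    (ρ : Measure ℝ) [IsFiniteMeasure ρ] :
    Integrable (fun p : X × ℝ => alongFlow φ J u p.1 p.2) (m.prod ρ) := by
  have hmeas : Measurable (fun p : X × ℝ => alongFlow φ J u p.1 p.2) :=
    (measurable_alongFlow hJ hu).comp measurable_swap
  refine (integrable_prod_iff' hmeas.aestronglyMeasurable).2
    ⟨Eventually.of_forall fun t => hm.integrable_alongFlow hJ t hu hui, ?_⟩
  have : ∀ t, ∫ y, ‖alongFlow φ J u y t‖ ∂m = ∫ x, ‖u x‖ ∂m := by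
    intro t
    rw [← hm.integral_alongFlow (u := fun x => ‖u x‖) hJ t hu.norm]
    refine integral_congr_ae (Eventually.of_forall fun y => ?_)
    simp [alongFlow, abs_of_nonneg (hJ.nonneg t y)]
  simp only [this]
  exact integrable_const _

theorem HasFlowDensity.ae_locallyIntegrable [SFinite m] (hJ : IsCocycle φ J)
    (hm : HasFlowDensity φ J m) {u : X → ℝ} (hu : Measurable u) (hui : Integrable u m) :
    ∀ᵐ y ∂m, LocallyIntegrable (alongFlow φ J u y) := by
  have : ∀ᵐ y ∂m, ∀ n : ℕ, IntegrableOn (alongFlow φ J u y) (Icc (-(n : ℝ)) n) :=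
    ae_all_iff.2 fun n => (hm.integrable_alongFlow_prod hJ hu hui
      (volume.restrict (Icc (-(n : ℝ)) n))).prod_right_ae
  filter_upwards [this] with y hy
  refine locallyIntegrable_iff.2 fun K hK => ?_
  obtain ⟨R, hR⟩ := hK.isBounded.subset_closedBall 0
  obtain ⟨n, hn⟩ := exists_nat_ge R
  refine (hy n).mono_set fun t ht => ?_
  have := hR ht
  rw [Metric.mem_closedBall, Real.dist_eq, sub_zero] at this
  exact abs_le.1 (this.trans hn)

/-- A Borel set which almost every orbit avoids at almost all times of a set of positive length is
a null set. -/
theorem HasFlowDensity.null_of_ae_orbit [SFinite m] (hm : HasFlowDensity φ J m) {N : Set X}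
    (hN : MeasurableSet N) {U : Set ℝ} (hU : volume U ≠ 0)
    (h : ∀ᵐ y ∂m, ∀ᵐ t ∂(volume.restrict U), φ t y ∉ N) : m N = 0 := by
  have hmeas : MeasurableSet {p : X × ℝ | φ p.2 p.1 ∉ N} :=
    ((measurable_flow φ).comp measurable_swap) hN.compl
  rw [Measure.ae_ae_comm hmeas] at h
  have hne : (ae (volume.restrict U)).NeBot := by
    rwa [ae_neBot, Ne, Measure.restrict_eq_zero]
  -- With the quantifiers exchanged, one good time suffices: the preimage of `N` under `φ_t` is
  -- null, and flowing back by `-t` preserves null sets.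
  obtain ⟨t, ht⟩ := h.exists
  have h0 : m ((fun x => φ t x) ⁻¹' N) = 0 := by
    simp only [ae_iff, not_not] at ht
    exact ht
  have := hm.preimage_null (-t) h0
  simpa [preimage, flow_flow_neg] using this

/-- An orbit meets `Γ⁻` only countably often, hence at Lebesgue-null times. Consequently `E` and
`E0` are interchangeable in all integrals against `m`. -/
theorem HasFlowDensity.measure_inBd [SFinite m] {E0 : Set X} (hm : HasFlowDensity φ J m)
    (hin : MeasurableSet (inBd φ E0)) : m (inBd φ E0) = 0 := by
  refine hm.null_of_ae_orbit hin (U := univ) (by simp) (Eventually.of_forall fun y => ?_)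
  rw [Measure.restrict_univ]
  simpa [ae_iff] using (countable_orbit_inBd (φ := φ) (E0 := E0) y).measure_zero volume

theorem HasFlowDensity.stateSp_ae_eq [SFinite m] {E0 : Set X} (hm : HasFlowDensity φ J m)
    (hin : MeasurableSet (inBd φ E0)) : stateSp φ E0 =ᵐ[m] E0 := by
  have h0 := hm.measure_inBd hin
  have : m (inBd φ E0 \ (inBd φ E0 ∩ outBd φ E0)) = 0 := measure_mono_null sdiff_subset h0
  simpa [stateSp] using union_ae_eq_left_of_ae_eq_empty (s := E0) (ae_eq_empty.2 this)

end Fubini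

/-! ### Cauchy's formula for iterated integrals. -/

section IntervalIntegral

theorem measurable_intervalIntegral {X : Type*} [MeasurableSpace X] {H : X → ℝ → ℝ}
    (hH : Measurable (Function.uncurry H)) (a b : ℝ) :
    Measurable (fun x => ∫ s in a..b, H x s) := by
  simp only [intervalIntegral]
  exact hH.stronglyMeasurable.integral_prod_right.measurable.sub
    hH.stronglyMeasurable.integral_prod_right.measurable

/-- Cauchy's formula for the iterated primitive of an integrable function. -/
theorem integral_integral_eq_integral_sub_mul {v : ℝ → ℝ} {u : ℝ}
    (hv : IntervalIntegrable v volume 0 u) :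
    ∫ s in 0..u, ∫ r in 0..s, v r = ∫ s in 0..u, (u - s) * v s := by
  have hS := hv.absolutelyContinuousOnInterval_intervalIntegral (c := 0) left_mem_uIcc
  -- Integrating by parts with `s - u` instead of `s` kills both boundary terms: this factor
  -- vanishes at `u`, the primitive at `0`.
  have hlip : AbsolutelyContinuousOnInterval (fun s : ℝ => s - u) 0 u := by
    have : LipschitzWith 1 (fun s : ℝ => s - u) :=
      LipschitzWith.of_dist_le_mul fun x y => by simp
    exact this.lipschitzOnWith.absolutelyContinuousOnInterval
  have hparts := hS.integral_mul_deriv_eq_deriv_mul hlip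
  have hd : ∀ s : ℝ, deriv (fun s : ℝ => s - u) s = 1 := fun s => by simp
  simp only [hd, mul_one, sub_self, mul_zero, intervalIntegral.integral_same, zero_mul,
    zero_sub] at hparts
  rw [hparts, ← intervalIntegral.integral_neg]
  refine intervalIntegral.integral_congr_ae ?_
  filter_upwards [hv.ae_hasDerivAt_integral] with s hs hsu
  rw [(hs (uIoc_subset_uIcc hsu) 0 left_mem_uIcc).deriv]
  ring

end IntervalIntegral

/-! ### Iterated time integrals of a bounded function along orbits. -/

section TimeIntegral

variable {X : Type*} [TopologicalSpace X] (φ : Flow ℝ X) (k : X → ℝ)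

/-- The integral of `k` over the orbit piece of `x` of length `t`. -/
noncomputable def timeInt (x : X) (t : ℝ) : ℝ := ∫ s in 0..t, k (φ s x)

/-- The primitive of `timeInt`. -/
noncomputable def timeInt₂ (x : X) (t : ℝ) : ℝ := ∫ s in 0..t, timeInt φ k x s

variable [SecondCountableTopology X] [MeasurableSpace X] [BorelSpace X] {φ k}
  (hk : Measurable k) (hk1 : ∀ x, |k x| ≤ 1)

include hk hk1

theorem intervalIntegrable_orbit (x : X) (a b : ℝ) :
    IntervalIntegrable (fun s => k (φ s x)) volume a b := by
  refine (intervalIntegrable_const (c := (1 : ℝ))).mono_fun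
    (hk.comp (measurable_flow_left φ x)).aestronglyMeasurable
    (Eventually.of_forall fun s => ?_)
  simpa using hk1 (φ s x)

theorem continuous_timeInt (x : X) : Continuous (timeInt φ k x) :=
  intervalIntegral.continuous_primitive (intervalIntegrable_orbit hk hk1 x) 0

theorem hasDerivAt_timeInt₂ (x : X) (t : ℝ) :
    HasDerivAt (timeInt₂ φ k x) (timeInt φ k x t) t :=
  ((continuous_timeInt hk hk1 x).integral_hasStrictDerivAt 0 t).hasDerivAt

theorem timeInt_flow (x : X) (t u : ℝ) :
    timeInt φ k (φ t x) u = timeInt φ k x (t + u) - timeInt φ k x t := by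
  have h := intervalIntegral.integral_comp_add_right (a := 0) (b := u) (fun s => k (φ s x)) t
  simp only [φ.map_add, zero_add] at h
  rw [timeInt, timeInt, timeInt, h, intervalIntegral.integral_interval_sub_left
    (intervalIntegrable_orbit hk hk1 x _ _) (intervalIntegrable_orbit hk hk1 x _ _), add_comm]

theorem timeInt₂_flow (x : X) (t u : ℝ) :
    timeInt₂ φ k (φ t x) u = timeInt₂ φ k x (t + u) - timeInt₂ φ k x t - u * timeInt φ k x t := by
  have hc := continuous_timeInt (φ := φ) hk hk1 x
  have h := intervalIntegral.integral_comp_add_left (a := 0) (b := u) (timeInt φ k x) t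
  rw [timeInt₂, timeInt₂, timeInt₂, intervalIntegral.integral_interval_sub_left
    (hc.intervalIntegrable _ _) (hc.intervalIntegrable _ _)]
  simp only [timeInt_flow hk hk1]
  have hi : IntervalIntegrable (fun s => timeInt φ k x (t + s)) volume 0 u :=
    (hc.comp (continuous_const.add continuous_id)).intervalIntegrable _ _
  rw [intervalIntegral.integral_sub hi intervalIntegrable_const, h]
  simp

theorem timeInt₂_eq (x : X) (u : ℝ) :
    timeInt₂ φ k x u = ∫ s in 0..u, (u - s) * k (φ s x) :=
  integral_integral_eq_integral_sub_mul (intervalIntegrable_orbit hk hk1 x 0 u)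

omit hk1 in
theorem measurable_timeInt (t : ℝ) : Measurable (fun x => timeInt φ k x t) :=
  measurable_intervalIntegral (H := fun x s => k (φ s x))
    (hk.comp ((measurable_flow φ).comp measurable_swap)) 0 t

theorem measurable_timeInt₂ (t : ℝ) : Measurable (fun x => timeInt₂ φ k x t) := by
  simp only [timeInt₂_eq hk hk1]
  exact measurable_intervalIntegral (H := fun x s => (t - s) * k (φ s x))
    ((measurable_const.sub measurable_snd).mul
      (hk.comp ((measurable_flow φ).comp measurable_swap))) 0 t

omit hk [SecondCountableTopology X] [MeasurableSpace X] [BorelSpace X] in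
theorem abs_timeInt_le (x : X) (t : ℝ) : |timeInt φ k x t| ≤ |t| := by
  have := intervalIntegral.norm_integral_le_of_norm_le_const (a := 0) (b := t) (C := 1)
    (f := fun s => k (φ s x)) (fun s _ => hk1 (φ s x))
  simpa [timeInt] using this

omit hk [SecondCountableTopology X] [MeasurableSpace X] [BorelSpace X] in
theorem abs_timeInt₂_le (x : X) (t : ℝ) : |timeInt₂ φ k x t| ≤ |t| * |t| := by
  have := intervalIntegral.norm_integral_le_of_norm_le_const (a := 0) (b := t) (C := |t|)
    (f := fun s => timeInt φ k x s) (fun s hs => (abs_timeInt_le hk1 x s).trans ?_)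
  · simpa [timeInt₂] using this
  · have := uIoc_subset_uIcc hs
    simpa using abs_sub_left_of_mem_uIcc this

end TimeIntegral

/-! ### The averaged test functions. -/

section TestFunctions

variable {X : Type*} [TopologicalSpace X] (φ : Flow ℝ X) (k : X → ℝ)

/-- The difference of second order of the iterated time integral of `k`. -/
noncomputable def averagedTestFun (τ h : ℝ) (x : X) : ℝ :=
  timeInt₂ φ k x (τ + h) - timeInt₂ φ k x τ - timeInt₂ φ k x h

variable {φ k}

theorem timeInt_eq_zero {x : X} {b : ℝ} (h : ∀ s ∈ Icc 0 b, k (φ s x) = 0) {u : ℝ}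
    (hu : u ∈ Icc 0 b) : timeInt φ k x u = 0 := by
  refine intervalIntegral.integral_zero_ae (Eventually.of_forall fun s hs => h s ?_)
  rw [uIoc_of_le hu.1] at hs
  exact ⟨hs.1.le, hs.2.trans hu.2⟩

theorem timeInt₂_eq_zero {x : X} {b : ℝ} (h : ∀ s ∈ Icc 0 b, k (φ s x) = 0) {u : ℝ}
    (hu : u ∈ Icc 0 b) : timeInt₂ φ k x u = 0 := by
  refine intervalIntegral.integral_zero_ae (Eventually.of_forall fun s hs =>
    timeInt_eq_zero h ?_)
  rw [uIoc_of_le hu.1] at hs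
  exact ⟨hs.1.le, hs.2.trans hu.2⟩

variable [SecondCountableTopology X] [MeasurableSpace X] [BorelSpace X]

/-- The terms of `timeInt₂_flow` that are linear in the time length cancel since `(τ + h) - τ - h =
0`. What remains along the orbit are time shifts of the C¹ function `timeInt₂ φ k x`; this is why a
second difference is taken. -/
theorem hasDerivAt_averagedTestFun (hk : Measurable k) (hk1 : ∀ x, |k x| ≤ 1) (τ h : ℝ) (x : X)
    (t : ℝ) : HasDerivAt (fun t => averagedTestFun φ k τ h (φ t x))
      (timeInt φ k x (t + (τ + h)) - timeInt φ k x (t + τ) - timeInt φ k x (t + h)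
        + timeInt φ k x t) t := by
  have heq : (fun t => averagedTestFun φ k τ h (φ t x)) = fun t =>
      timeInt₂ φ k x (t + (τ + h)) - timeInt₂ φ k x (t + τ) - timeInt₂ φ k x (t + h)
        + timeInt₂ φ k x t := by
    funext t
    simp only [averagedTestFun, timeInt₂_flow hk hk1]
    ring
  rw [heq]
  have hd := hasDerivAt_timeInt₂ (φ := φ) hk hk1 x
  have hs : ∀ c, HasDerivAt (fun t => timeInt₂ φ k x (t + c)) (timeInt φ k x (t + c)) t :=
    fun c => (hd (t + c)).comp_add_const t c
  exact (((hs _).sub (hs _)).sub (hs _)).add (hd t)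

theorem flowDeriv_averagedTestFun (hk : Measurable k) (hk1 : ∀ x, |k x| ≤ 1) (τ h : ℝ) (x : X) :
    flowDeriv φ (averagedTestFun φ k τ h) x =
      timeInt φ k x (τ + h) - timeInt φ k x τ - timeInt φ k x h := by
  rw [flowDeriv, (hasDerivAt_averagedTestFun hk hk1 τ h x 0).deriv]
  simp [timeInt]

theorem measurable_averagedTestFun (hk : Measurable k) (hk1 : ∀ x, |k x| ≤ 1) (τ h : ℝ) :
    Measurable (averagedTestFun φ k τ h) :=
  ((measurable_timeInt₂ hk hk1 _).sub (measurable_timeInt₂ hk hk1 _)).sub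
    (measurable_timeInt₂ hk hk1 _)

/-- The value at `x` only depends on `k` along the orbit of `x` during `[0, τ + h]`. The support
therefore lies in the compact set swept out by `K` under the backward flow during this time, which
`hKE` places inside `E0`. -/
theorem isTestFun_averagedTestFun {E0 : Set X} (hk : Measurable k) (hk1 : ∀ x, |k x| ≤ 1)
    {τ h : ℝ} (hτ : 0 ≤ τ) (hh : 0 ≤ h) {K : Set X} (hK : IsCompact K) (hkK : ∀ x ∉ K, k x = 0)
    (hKE : ∀ y ∈ K, ∀ s ∈ Icc 0 (τ + h), φ (-s) y ∈ E0) :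
    IsTestFun φ E0 (averagedTestFun φ k τ h) where
  measurable := measurable_averagedTestFun hk hk1 τ h
  bounded := by
    refine ⟨|τ + h| * |τ + h| + |τ| * |τ| + |h| * |h|, fun x => ?_⟩
    have h1 := abs_le.1 (abs_timeInt₂_le (φ := φ) hk1 x (τ + h))
    have h2 := abs_le.1 (abs_timeInt₂_le (φ := φ) hk1 x τ)
    have h3 := abs_le.1 (abs_timeInt₂_le (φ := φ) hk1 x h)
    rw [averagedTestFun, abs_le]
    constructor <;> linarith [h1.1, h1.2, h2.1, h2.2, h3.1, h3.2]
  compact_support := by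
    refine ⟨(fun p : ℝ × X => φ (-p.1) p.2) '' (Icc 0 (τ + h) ×ˢ K),
      (isCompact_Icc.prod hK).image (φ.continuous continuous_fst.neg continuous_snd), ?_, ?_⟩
    · rintro _ ⟨⟨s, y⟩, ⟨hs, hy⟩, rfl⟩
      exact hKE y hy s hs
    · intro x hx
      have h0 : ∀ s ∈ Icc 0 (τ + h), k (φ s x) = 0 := fun s hs =>
        hkK _ fun hmem => hx ⟨(s, φ s x), ⟨hs, hmem⟩, flow_neg_flow φ s x⟩
      rw [averagedTestFun, timeInt₂_eq_zero h0 ⟨by linarith, le_rfl⟩,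
        timeInt₂_eq_zero h0 ⟨hτ, by linarith⟩, timeInt₂_eq_zero h0 ⟨hh, by linarith⟩]
      simp
  contDiff x _ := by
    have hd := hasDerivAt_averagedTestFun (φ := φ) hk hk1 τ h x
    refine ContDiff.contDiffOn (contDiff_one_iff_deriv.2 ⟨fun t => (hd t).differentiableAt, ?_⟩)
    rw [show deriv (fun t => averagedTestFun φ k τ h (φ t x)) = _ from funext fun t => (hd t).deriv]
    have hc := continuous_timeInt (φ := φ) hk hk1 x
    fun_prop
  measurable_deriv := by
    simp only [funext (flowDeriv_averagedTestFun (φ := φ) hk hk1 τ h)]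
    exact ((measurable_timeInt hk _).sub (measurable_timeInt hk _)).sub (measurable_timeInt hk _)
  bounded_deriv := by
    refine ⟨|τ + h| + |τ| + |h|, fun x => ?_⟩
    have h1 := abs_le.1 (abs_timeInt_le (φ := φ) hk1 x (τ + h))
    have h2 := abs_le.1 (abs_timeInt_le (φ := φ) hk1 x τ)
    have h3 := abs_le.1 (abs_timeInt_le (φ := φ) hk1 x h)
    rw [flowDeriv_averagedTestFun hk hk1, abs_le]
    constructor <;> linarith [h1.1, h1.2, h2.1, h2.2, h3.1, h3.2]

end TestFunctions

/-! ### From the weak equation to additivity of `balance`. -/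

section Duality

variable {X : Type*} [TopologicalSpace X] [SecondCountableTopology X] [MeasurableSpace X]
  [BorelSpace X] {φ : Flow ℝ X} {J : ℝ → X → ℝ} {m : Measure X} [SFinite m]

theorem HasFlowDensity.integrable_weighted_alongFlow (hJ : IsCocycle φ J)
    (hm : HasFlowDensity φ J m) {u : X → ℝ} (hu : Measurable u) (hui : Integrable u m)
    {c : ℝ → ℝ} (hc : Continuous c) (b : ℝ) :
    Integrable (fun p : X × ℝ => alongFlow φ J u p.1 (-p.2) * c p.2)
      (m.prod (volume.restrict (Ioc 0 b))) := by
  obtain ⟨C, hC⟩ := (isCompact_Icc (a := (0 : ℝ)) (b := b)).exists_bound_of_continuousOn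
    hc.continuousOn
  refine (hm.reverse.integrable_alongFlow_prod hJ.reverse hu hui _).mul_bdd (c := C)
    (hc.measurable.comp measurable_snd).aestronglyMeasurable ?_
  exact Measure.quasiMeasurePreserving_snd.ae ((ae_restrict_mem measurableSet_Ioc).mono
    fun t ht => hC t (Ioc_subset_Icc_self ht))

theorem HasFlowDensity.integrable_intervalIntegral_alongFlow (hJ : IsCocycle φ J)
    (hm : HasFlowDensity φ J m) {u : X → ℝ} (hu : Measurable u) (hui : Integrable u m)
    {c : ℝ → ℝ} (hc : Continuous c) {b : ℝ} (hb : 0 ≤ b) :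
    Integrable (fun y => ∫ r in 0..b, c r * alongFlow φ J u y (-r)) m := by
  simp only [intervalIntegral.integral_of_le hb, mul_comm (c _)]
  exact (hm.integrable_weighted_alongFlow hJ hu hui hc b).integral_prod_left

/-- Fubini and `integral_alongFlow_mul` at each time `r` shift an average along forward orbits from
the test function to an average of `u` along backward orbits. -/
theorem HasFlowDensity.integral_mul_intervalIntegral (hJ : IsCocycle φ J)
    (hm : HasFlowDensity φ J m) {u : X → ℝ} (hu : Measurable u) (hui : Integrable u m)
    {k : X → ℝ} (hk : Measurable k) (hk1 : ∀ x, |k x| ≤ 1)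
    {c : ℝ → ℝ} (hc : Continuous c) {b : ℝ} (hb : 0 ≤ b) :
    ∫ x, u x * (∫ r in 0..b, c r * k (φ r x)) ∂m =
      ∫ y, (∫ r in 0..b, c r * alongFlow φ J u y (-r)) * k y ∂m := by
  simp only [intervalIntegral.integral_of_le hb, ← integral_const_mul, ← integral_mul_const]
  obtain ⟨C, hC⟩ := (isCompact_Icc (a := (0 : ℝ)) (b := b)).exists_bound_of_continuousOn
    hc.continuousOn
  have hi1 : Integrable (Function.uncurry fun x r => u x * (c r * k (φ r x)))
      (m.prod (volume.restrict (Ioc 0 b))) := by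
    refine (hui.comp_fst (volume.restrict (Ioc 0 b))).mul_bdd (c := C)
      ((hc.measurable.comp measurable_snd).mul (hk.comp ((measurable_flow φ).comp
        measurable_swap))).aestronglyMeasurable ?_
    have hmem : ∀ᵐ p : X × ℝ ∂(m.prod (volume.restrict (Ioc 0 b))), p.2 ∈ Ioc 0 b :=
      Measure.quasiMeasurePreserving_snd.ae (ae_restrict_mem measurableSet_Ioc)
    filter_upwards [hmem] with p hp
    rw [norm_mul]
    exact (mul_le_of_le_one_right (norm_nonneg _) (hk1 _)).trans (hC _ (Ioc_subset_Icc_self hp))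
  have hi2 : Integrable (Function.uncurry fun y r => c r * alongFlow φ J u y (-r) * k y)
      (m.prod (volume.restrict (Ioc 0 b))) := by
    refine ((hm.integrable_weighted_alongFlow hJ hu hui hc b).mul_bdd (c := 1)
      (hk.comp measurable_fst).aestronglyMeasurable
      (Eventually.of_forall fun p => hk1 p.1)).congr (Eventually.of_forall fun p => ?_)
    simp only [Function.uncurry, Function.comp_apply]
    ring
  rw [integral_integral_swap hi1, integral_integral_swap hi2]
  refine integral_congr_ae (Eventually.of_forall fun r => ?_)
  have := hm.integral_alongFlow_mul hJ (-r) hu hk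
  rw [neg_neg] at this
  calc ∫ x, u x * (c r * k (φ r x)) ∂m = c r * ∫ x, u x * k (φ r x) ∂m := by
        rw [← integral_const_mul]
        exact integral_congr_ae (Eventually.of_forall fun x => by ring_nf)
    _ = ∫ y, c r * alongFlow φ J u y (-r) * k y ∂m := by
        rw [← this, ← integral_const_mul]
        exact integral_congr_ae (Eventually.of_forall fun x => by ring_nf)

/-- A function whose integrals over the compact subsets of a Borel set vanish, vanishes almost
everywhere on this set. -/
theorem ae_eq_zero_of_setIntegral_isCompact_subset {Y : Type*} [TopologicalSpace Y] [T2Space Y]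
    [MeasurableSpace Y] [OpensMeasurableSpace Y] {ν : Measure Y} [ν.InnerRegular] {A : Set Y}
    (hA : MeasurableSet A) {D : Y → ℝ} (hD : Measurable D) (hDi : Integrable D ν)
    (h : ∀ K ⊆ A, IsCompact K → ∫ y in K, D y ∂ν = 0) : ∀ᵐ y ∂ν, y ∈ A → D y = 0 := by
  have key : ∀ D' : Y → ℝ, Measurable D' → Integrable D' ν →
      (∀ K ⊆ A, IsCompact K → ∫ y in K, D' y ∂ν = 0) → ν (A ∩ {y | 0 < D' y}) = 0 := by
    intro D' hD' hDi' h'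
    by_contra hne
    obtain ⟨K, hKA, hK, hpos⟩ := (hA.inter (measurableSet_lt measurable_const
      hD')).exists_lt_isCompact (pos_iff_ne_zero.2 hne)
    have hint := h' K (hKA.trans inter_subset_left) hK
    have hnn : 0 ≤ᵐ[ν.restrict K] D' :=
      (ae_restrict_mem hK.measurableSet).mono fun y hy => (hKA hy).2.le
    have := (setIntegral_pos_iff_support_of_nonneg_ae hnn hDi'.integrableOn).2
      (by
        rwa [inter_eq_right.2 fun y hy => ?_]
        exact (hKA hy).2.ne')
    exact this.ne' hint
  have h1 := key D hD hDi h
  have h2 := key (fun y => -D y) hD.neg hDi.neg fun K hKA hK => by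
    rw [integral_neg, h K hKA hK, neg_zero]
  filter_upwards [measure_eq_zero_iff_ae_notMem.1 h1, measure_eq_zero_iff_ae_notMem.1 h2]
    with y hy1 hy2 hyA
  by_contra hne
  rcases lt_or_gt_of_ne hne with hlt | hgt
  · exact hy2 ⟨hyA, by simpa using hlt⟩
  · exact hy1 ⟨hyA, hgt⟩

variable (φ J) in
/-- The primitive of `f - ∫ g` along the backward orbit of `y`. It is a linear function of `u` if
`f` and `g` are related by the transport equation. -/
noncomputable def balance (f g : X → ℝ) (y : X) (u : ℝ) : ℝ :=
  (∫ s in 0..u, alongFlow φ J f y (-s)) - ∫ s in 0..u, (u - s) * alongFlow φ J g y (-s)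

theorem measurable_balance (hJ : IsCocycle φ J) {f g : X → ℝ} (hf : Measurable f)
    (hg : Measurable g) (u : ℝ) : Measurable (fun y => balance φ J f g y u) := by
  have h : ∀ {v : X → ℝ}, Measurable v →
      Measurable (fun p : X × ℝ => alongFlow φ J v p.1 (-p.2)) := fun hv =>
    (measurable_alongFlow hJ hv).comp (measurable_snd.neg.prodMk measurable_fst)
  exact (measurable_intervalIntegral (H := fun y s => alongFlow φ J f y (-s)) (h hf) 0 u).sub
    (measurable_intervalIntegral (H := fun y s => (u - s) * alongFlow φ J g y (-s))
      ((measurable_const.sub measurable_snd).mul (h hg)) 0 u)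

theorem HasFlowDensity.integrable_balance (hJ : IsCocycle φ J) (hm : HasFlowDensity φ J m)
    {f g : X → ℝ} (hf : Measurable f) (hg : Measurable g) (hfi : Integrable f m)
    (hgi : Integrable g m) {u : ℝ} (hu : 0 ≤ u) :
    Integrable (fun y => balance φ J f g y u) m := by
  refine Integrable.sub ?_ (hm.integrable_intervalIntegral_alongFlow hJ hg hgi
    (c := fun s => u - s) (by fun_prop) hu)
  simpa using hm.integrable_intervalIntegral_alongFlow hJ hf hfi (c := fun _ => 1)
    continuous_const hu

/-- Testing the weak transport equation with averaged test functions shows that `balance` is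
additive. -/
theorem ae_balance_add [T2Space X] [m.InnerRegular] {E0 : Set X} (hJ : IsCocycle φ J)
    (hm : HasFlowDensity φ J m)
    {f g : X → ℝ} (hf : Measurable f) (hg : Measurable g) (hfi : Integrable f m)
    (hgi : Integrable g m)
    (hweak : ∀ ψ, IsTestFun φ E0 ψ → ∫ x, g x * ψ x ∂m = ∫ x, f x * flowDeriv φ ψ x ∂m)
    {τ h : ℝ} (hτ : 0 ≤ τ) (hh : 0 ≤ h)
    (hA : MeasurableSet {y | ∀ s ∈ Icc 0 (τ + h), φ (-s) y ∈ E0}) :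
    ∀ᵐ y ∂m, (∀ s ∈ Icc 0 (τ + h), φ (-s) y ∈ E0) →
      balance φ J f g y (τ + h) = balance φ J f g y τ + balance φ J f g y h := by
  have hτh : 0 ≤ τ + h := add_nonneg hτ hh
  have hmeas := measurable_balance hJ hf hg
  have hint : ∀ u, 0 ≤ u → Integrable (fun y => balance φ J f g y u) m :=
    fun u hu => hm.integrable_balance hJ hf hg hfi hgi hu
  suffices hD : ∀ᵐ y ∂m, y ∈ {y | ∀ s ∈ Icc 0 (τ + h), φ (-s) y ∈ E0} →
      balance φ J f g y (τ + h) - balance φ J f g y τ - balance φ J f g y h = 0 by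
    filter_upwards [hD] with y hy hyA
    linarith [hy hyA]
  refine ae_eq_zero_of_setIntegral_isCompact_subset hA (((hmeas _).sub (hmeas _)).sub (hmeas _))
    (((hint _ hτh).sub (hint _ hτ)).sub (hint _ hh)) fun K hKA hK => ?_
  set k : X → ℝ := K.indicator fun _ => 1 with hkdef
  have hk : Measurable k := measurable_const.indicator hK.measurableSet
  have hk1 : ∀ x, |k x| ≤ 1 := fun x => by
    by_cases hx : x ∈ K <;> simp [hkdef, hx]
  have hmul : ∀ v : X → ℝ, ∫ y in K, v y ∂m = ∫ y, v y * k y ∂m := fun v => by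
    rw [← integral_indicator hK.measurableSet]
    refine integral_congr_ae (Eventually.of_forall fun y => ?_)
    by_cases hy : y ∈ K <;> simp [hkdef, hy]
  have htest := hweak _ (isTestFun_averagedTestFun (E0 := E0) hk hk1 hτ hh hK
    (fun x hx => by simp [hkdef, hx]) fun y hy => hKA hy)
  have hik : ∀ {v : X → ℝ}, Integrable v m → Integrable (fun y => v y * k y) m := fun hv =>
    hv.mul_bdd (c := 1) hk.aestronglyMeasurable (Eventually.of_forall hk1)
  have hg2 : ∀ u, 0 ≤ u → ∫ x, g x * timeInt₂ φ k x u ∂m =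
      ∫ y, (∫ s in 0..u, (u - s) * alongFlow φ J g y (-s)) * k y ∂m := fun u hu => by
    simp only [timeInt₂_eq hk hk1]
    exact hm.integral_mul_intervalIntegral hJ hg hgi hk hk1 (c := fun s => u - s)
      (by fun_prop) hu
  have hf1 : ∀ u, 0 ≤ u → ∫ x, f x * timeInt φ k x u ∂m =
      ∫ y, (∫ s in 0..u, alongFlow φ J f y (-s)) * k y ∂m := fun u hu => by
    simpa [timeInt] using hm.integral_mul_intervalIntegral hJ hf hfi hk hk1 (c := fun _ => 1)
      continuous_const hu
  have hgi2 : ∀ u, Integrable (fun x => g x * timeInt₂ φ k x u) m := fun u =>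
    hgi.mul_bdd (measurable_timeInt₂ hk hk1 u).aestronglyMeasurable
      (Eventually.of_forall fun x => abs_timeInt₂_le hk1 x u)
  have hfi1 : ∀ u, Integrable (fun x => f x * timeInt φ k x u) m := fun u =>
    hfi.mul_bdd (measurable_timeInt hk u).aestronglyMeasurable
      (Eventually.of_forall fun x => abs_timeInt_le hk1 x u)
  have hbal : ∀ u, 0 ≤ u → ∫ y, balance φ J f g y u * k y ∂m =
      ∫ x, f x * timeInt φ k x u ∂m - ∫ x, g x * timeInt₂ φ k x u ∂m := fun u hu => by
    rw [hf1 u hu, hg2 u hu, ← integral_sub]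
    · exact integral_congr_ae (Eventually.of_forall fun y => by simp only [balance]; ring)
    · refine hik ?_
      simpa using hm.integrable_intervalIntegral_alongFlow hJ hf hfi (c := fun _ => 1)
        continuous_const hu
    · exact hik (hm.integrable_intervalIntegral_alongFlow hJ hg hgi
        (c := fun s => u - s) (by fun_prop) hu)
  have hsub : ∀ {a b c : X → ℝ}, Integrable a m → Integrable b m → Integrable c m →
      ∫ x, (a x - b x - c x) ∂m = ∫ x, a x ∂m - ∫ x, b x ∂m - ∫ x, c x ∂m :=
    fun {a b c} ha hb hc => by
      rw [← integral_sub ha hb]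
      exact integral_sub (ha.sub hb) hc
  -- The test function and its derivative are the same second difference in `u` of `timeInt₂` and
  -- `timeInt`, so by `hbal` the weak equation is the vanishing integral over `K` of the second
  -- difference of `balance`.
  simp only [averagedTestFun, flowDeriv_averagedTestFun hk hk1, mul_sub] at htest
  rw [hsub (hgi2 _) (hgi2 _) (hgi2 _), hsub (hfi1 _) (hfi1 _) (hfi1 _)] at htest
  rw [hmul]
  simp only [sub_mul]
  rw [hsub (hik (hint _ hτh)) (hik (hint _ hτ)) (hik (hint _ hh)), hbal _ hτh, hbal _ hτ,
    hbal _ hh]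
  linarith

end Duality

/-! ### Additive functions and derivatives of iterated integrals. -/

section RealAnalysis

/-- A continuous function that is additive on the rational points of `[0, b]` is linear there. -/
theorem eq_mul_div_of_rat_additive {P : ℝ → ℝ} (hP : Continuous P) {b : ℚ} (hb : 0 < b)
    (hadd : ∀ τ h : ℚ, 0 ≤ τ → 0 ≤ h → τ + h ≤ b → P (τ + h) = P τ + P h) {u : ℝ}
    (hu : u ∈ Icc 0 (b : ℝ)) : P u = u * (P b / b) := by
  have hbR : (0 : ℝ) < b := by exact_mod_cast hb
  have hmul : ∀ (x : ℚ), 0 ≤ x → ∀ k : ℕ, k * x ≤ b → P (k * x : ℚ) = k * P x := by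
    intro x hx k
    induction k with
    | zero =>
      intro _
      have := hadd 0 0 le_rfl le_rfl (by simpa using hb.le)
      simp only [Rat.cast_zero, add_zero] at this
      simp only [Nat.cast_zero, zero_mul, Rat.cast_zero]
      linarith
    | succ k ih =>
      intro hk
      have h1 : (k : ℚ) * x + x ≤ b := by
        have : ((k + 1 : ℕ) : ℚ) * x = k * x + x := by push_cast; ring
        linarith
      have h2 := hadd (k * x) x (by positivity) hx h1
      have h3 := ih (by linarith)
      rw [h3] at h2
      have h4 : (((k + 1 : ℕ) : ℚ) * x : ℚ) = k * x + x := by push_cast; ring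
      rw [h4, Rat.cast_add, h2]
      push_cast
      ring
  have hrat : ∀ q : ℚ, q ∈ Icc (0 : ℚ) 1 → P (q * b) = q * b * (P b / b) := by
    intro q hq
    have hd : (0 : ℚ) < q.den := by exact_mod_cast q.den_pos
    have hn : (q.num.toNat : ℚ) = q.num := by
      have := Int.toNat_of_nonneg (Rat.num_nonneg.2 hq.1)
      exact_mod_cast this
    have hqe : q = q.num.toNat / q.den := by rw [hn, Rat.num_div_den]
    -- `P b` and `P (q * b)` are both natural multiples of the value at `b / q.den`, which is then
    -- eliminated.
    have h1 := hmul (b / q.den) (by positivity) q.den (by rw [mul_div_cancel₀ _ hd.ne'])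
    rw [mul_div_cancel₀ _ hd.ne'] at h1
    have h2 : (q.num.toNat : ℚ) * (b / q.den) = q * b := by
      conv_rhs => rw [hqe]
      ring
    have h3 := hmul (b / q.den) (by positivity) q.num.toNat (by
      rw [h2]; nlinarith [hq.2])
    rw [h2] at h3
    have hqR : (q : ℝ) = q.num.toNat / q.den := by
      have := congrArg (Rat.cast (K := ℝ)) hqe
      rwa [Rat.cast_div, Rat.cast_natCast, Rat.cast_natCast] at this
    have hdR : (0 : ℝ) < q.den := by exact_mod_cast q.den_pos
    have h4 : P ((b / q.den : ℚ) : ℝ) = P b / q.den := by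
      rw [h1]; field_simp
    rw [h4, Rat.cast_mul] at h3
    rw [h3]
    conv_rhs => rw [hqR]
    field_simp
  have hclosed : IsClosed {q : ℝ | P (q * b) = q * b * (P b / b)} :=
    isClosed_eq (by fun_prop) (by fun_prop)
  have hsub : Icc (0 : ℝ) 1 ⊆ {q : ℝ | P (q * b) = q * b * (P b / b)} := by
    have hdense : Icc (0 : ℝ) 1 ⊆ closure (Ioo (0 : ℝ) 1 ∩ range ((↑) : ℚ → ℝ)) := by
      rw [← closure_Ioo zero_ne_one]
      exact closure_minimal (Rat.denseRange_cast.open_subset_closure_inter isOpen_Ioo)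
        isClosed_closure
    refine hdense.trans (closure_minimal ?_ hclosed)
    rintro _ ⟨hq, q, rfl⟩
    exact hrat q ⟨by exact_mod_cast hq.1.le, by exact_mod_cast hq.2.le⟩
  have := hsub (⟨div_nonneg hu.1 hbR.le, (div_le_one hbR).2 hu.2⟩ : u / b ∈ Icc (0 : ℝ) 1)
  simpa [div_mul_cancel₀ _ hbR.ne'] using this

theorem tendsto_succ_mul_sub_of_hasDerivWithinAt {Φ : ℝ → ℝ} {u L : ℝ}
    (h : HasDerivWithinAt Φ L (Ioi u) u) :
    Tendsto (fun n : ℕ => ((n : ℝ) + 1) * (Φ (u + 1 / ((n : ℝ) + 1)) - Φ u)) atTop (𝓝 L) := by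
  have h1 := (hasDerivWithinAt_iff_tendsto_slope' self_notMem_Ioi).1 h
  have h2 : Tendsto (fun n : ℕ => u + 1 / ((n : ℝ) + 1)) atTop (𝓝[>] u) := by
    refine tendsto_nhdsWithin_iff.2 ⟨?_, Eventually.of_forall fun n => ?_⟩
    · simpa using tendsto_const_nhds.add (tendsto_one_div_add_atTop_nhds_zero_nat (𝕜 := ℝ))
    · have : (0 : ℝ) < 1 / ((n : ℝ) + 1) := by positivity
      simpa using this
  refine (h1.comp h2).congr fun n => ?_
  simp [slope_def_field, div_eq_mul_inv, mul_comm]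

theorem hasDerivAt_integral_integral {v : ℝ → ℝ} (hv : ∀ a b, IntervalIntegrable v volume a b)
    (u : ℝ) : HasDerivAt (fun u => ∫ s in 0..u, (u - s) * v s) (∫ s in 0..u, v s) u := by
  have : (fun u => ∫ s in 0..u, (u - s) * v s) = fun u => ∫ s in 0..u, ∫ r in 0..s, v r :=
    funext fun u => (integral_integral_eq_integral_sub_mul (hv 0 u)).symm
  rw [this]
  exact ((intervalIntegral.continuous_primitive hv 0).integral_hasStrictDerivAt 0 u).hasDerivAt

end RealAnalysis

/-! ### The representative defined by backward averages. -/

section Regularize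

variable {X : Type*} [TopologicalSpace X] (φ : Flow ℝ X) (J : ℝ → X → ℝ)

/-- The representative of `f` that is obtained by averaging backwards along the flow. -/
noncomputable def regularize (f : X → ℝ) (y : X) : ℝ :=
  limUnder atTop (fun n : ℕ =>
    ((n : ℝ) + 1) * ∫ s in 0..(1 / ((n : ℝ) + 1)), alongFlow φ J f y (-s))

variable {φ J}

theorem intervalIntegrable_alongFlow_neg {v : X → ℝ} {y : X}
    (h : LocallyIntegrable (alongFlow φ J v y)) (a b : ℝ) :
    IntervalIntegrable (fun s => alongFlow φ J v y (-s)) volume a b := by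
  have : IntervalIntegrable (alongFlow φ J v y) volume (-a) (-b) :=
    (h.integrableOn_isCompact isCompact_uIcc).intervalIntegrable
  simpa using (IntervalIntegrable.iff_comp_neg (by simp)).1 this

variable [SecondCountableTopology X] [MeasurableSpace X] [BorelSpace X]

theorem measurable_regularize (hJ : IsCocycle φ J) {f : X → ℝ} (hf : Measurable f) :
    Measurable (regularize φ J f) := by
  refine (StronglyMeasurable.limUnder (l := atTop) fun n : ℕ => ?_).measurable
  refine (measurable_const.mul ?_).stronglyMeasurable
  exact measurable_intervalIntegral (H := fun y s => alongFlow φ J f y (-s))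
    ((measurable_alongFlow hJ hf).comp (measurable_snd.neg.prodMk measurable_fst)) _ _

omit [SecondCountableTopology X] [BorelSpace X] in
-- By the cocycle law the averages at `φ (-u) y`, scaled by `J (-u) y`, are right difference
-- quotients at `u` of one primitive on the orbit of `y`. So the representative is identified at
-- every `u` where this primitive has a right derivative, not merely at almost every `u`.
theorem alongFlow_regularize (hJ : IsCocycle φ J) {f : X → ℝ} {y : X}
    (hf : LocallyIntegrable (alongFlow φ J f y)) {u L : ℝ}
    (h : HasDerivWithinAt (fun u => ∫ s in 0..u, alongFlow φ J f y (-s)) L (Ioi u) u) :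
    alongFlow φ J (regularize φ J f) y (-u) = L := by
  have hpos := hJ.pos (-u) y
  have hlim := tendsto_succ_mul_sub_of_hasDerivWithinAt h
  have heq : ∀ n : ℕ, ((n : ℝ) + 1) * ((∫ s in 0..(u + 1 / ((n : ℝ) + 1)),
      alongFlow φ J f y (-s)) - ∫ s in 0..u, alongFlow φ J f y (-s)) =
      ((n : ℝ) + 1) * (∫ s in 0..(1 / ((n : ℝ) + 1)), alongFlow φ J f (φ (-u) y) (-s)) *
        J (-u) y := by
    intro n
    rw [intervalIntegral.integral_interval_sub_left
      (intervalIntegrable_alongFlow_neg hf _ _) (intervalIntegrable_alongFlow_neg hf _ _),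
      mul_assoc, ← intervalIntegral.integral_mul_const]
    simp only [alongFlow_flow_mul hJ]
    have := intervalIntegral.integral_comp_add_right (a := 0) (b := 1 / ((n : ℝ) + 1))
      (fun s => alongFlow φ J f y (-s)) u
    simp only [neg_add, zero_add] at this
    rw [this, add_comm u]
  simp only [heq] at hlim
  have hlim2 := hlim.div_const (J (-u) y)
  simp only [mul_div_cancel_right₀ _ hpos.ne'] at hlim2
  rw [alongFlow, regularize, hlim2.limUnder_eq, div_mul_cancel₀ _ hpos.ne']

/-- Lebesgue differentiation on almost every orbit shows that the orbit avoids the exceptional set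
at almost all times, so `null_of_ae_orbit` applies. -/
theorem HasFlowDensity.regularize_ae_eq {m : Measure X} [SFinite m] (hJ : IsCocycle φ J)
    (hm : HasFlowDensity φ J m) {f : X → ℝ} (hf : Measurable f) (hfi : Integrable f m) :
    regularize φ J f =ᵐ[m] f := by
  have hN : MeasurableSet {x | regularize φ J f x ≠ f x} :=
    (measurableSet_eq_fun (measurable_regularize hJ hf) hf).compl
  refine hm.null_of_ae_orbit hN (U := univ) (by simp) ?_
  rw [Measure.restrict_univ]
  filter_upwards [hm.ae_locallyIntegrable hJ hf hfi] with y hy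
  have hloc : LocallyIntegrable (fun s => alongFlow φ J f y (-s)) := by
    refine locallyIntegrable_iff.2 fun K hK => ?_
    obtain ⟨R, hR⟩ := hK.isBounded.subset_closedBall 0
    rw [Real.closedBall_eq_Icc] at hR
    refine IntegrableOn.mono_set ?_ hR
    rcases le_or_gt 0 R with h0 | h0
    · have := intervalIntegrable_alongFlow_neg hy (0 - R) (0 + R)
      rwa [intervalIntegrable_iff_integrableOn_Icc_of_le (by linarith)] at this
    · rw [Icc_eq_empty (by linarith)]
      exact integrableOn_empty
  have hneg : ∀ᵐ u : ℝ, φ (-u) y ∉ {x | regularize φ J f x ≠ f x} := by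
    filter_upwards [LocallyIntegrable.ae_hasDerivAt_integral hloc] with u hu
    have := alongFlow_regularize hJ hy (hu 0).hasDerivWithinAt
    simpa [alongFlow, (hJ.pos (-u) y).ne'] using this
  have := (Measure.measurePreserving_neg (volume : Measure ℝ)).quasiMeasurePreserving.ae hneg
  simpa using this

end Regularize

/-! ### The transport equation along orbits. -/

section SolvesAlong

variable {X : Type*} [TopologicalSpace X] (φ : Flow ℝ X) (J : ℝ → X → ℝ) (E0 : Set X)

/-- The transport equation in integrated form, on the backward orbit of `y` inside `E0`. -/
def SolvesAlong (f g : X → ℝ) (y : X) : Prop :=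
  ∀ u : ℝ, 0 ≤ u → (∀ s ∈ Icc 0 u, φ (-s) y ∈ E0) →
    alongFlow φ J f y (-u) = f y + ∫ s in 0..u, alongFlow φ J g y (-s)

variable {φ J E0}

theorem exists_rat_forall_mem (hE0 : ∀ x : X, IsOpen {t : ℝ | φ t x ∈ E0}) {y : X} {u : ℝ}
    (h : ∀ s ∈ Icc 0 u, φ s y ∈ E0) (hu : 0 ≤ u) :
    ∃ ρ : ℚ, u < ρ ∧ ∀ s ∈ Icc 0 (ρ : ℝ), φ s y ∈ E0 := by
  have hu' : u ∈ {t : ℝ | φ t y ∈ E0} := h u ⟨hu, le_rfl⟩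
  obtain ⟨ε, hε, hball⟩ := Metric.isOpen_iff.1 (hE0 y) u hu'
  obtain ⟨ρ, hρ1, hρ2⟩ := exists_rat_btwn (show u < u + ε by linarith)
  refine ⟨ρ, hρ1, fun s hs => ?_⟩
  rcases le_or_gt s u with hsu | hsu
  · exact h s ⟨hs.1, hsu⟩
  · refine hball ?_
    rw [Metric.mem_ball, Real.dist_eq, abs_of_pos (by linarith)]
    linarith [hs.2]

variable [MeasurableSpace X]

/-- The uncountable intersection over `s` is, for `r > 0`, the single condition `r < t₋` on `E0`. -/
theorem BorelGeometry.measurableSet_backward (hB : BorelGeometry φ E0)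
    (hE0 : ∀ x : X, IsOpen {t : ℝ | φ t x ∈ E0}) {r : ℝ} (hr : 0 ≤ r) :
    MeasurableSet {y | ∀ s ∈ Icc 0 r, φ (-s) y ∈ E0} := by
  rcases hr.eq_or_lt with rfl | hr
  · simpa using hB.measurableSet_E0
  obtain ⟨T, hT, hTeq⟩ := hB.reverse.exists_measurable_tPlus
  have : {y | ∀ s ∈ Icc 0 r, φ (-s) y ∈ E0} = E0 ∩ {y | (r : EReal) < T y} := by
    ext y
    refine ⟨fun h => ?_, fun h s hs => ?_⟩
    · have hy : y ∈ E0 := by simpa using h 0 ⟨le_rfl, hr.le⟩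
      refine ⟨hy, ?_⟩
      rw [mem_ofPred_eq, hTeq y (.inl hy), coe_lt_tPlus_iff (isOpen_orbit_reverse hE0) (.inl hy) hr]
      exact fun s hs => h s ⟨hs.1.le, hs.2⟩
    · rcases hs.1.eq_or_lt with rfl | hs0
      · simpa using h.1
      · have h2 := h.2
        rw [mem_ofPred_eq, hTeq y (.inl h.1),
          coe_lt_tPlus_iff (isOpen_orbit_reverse hE0) (.inl h.1) hr] at h2
        exact h2 s ⟨hs0, hs.2⟩
  rw [this]
  exact hB.measurableSet_E0.inter (measurableSet_lt measurable_const hT)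

variable [SecondCountableTopology X] [BorelSpace X]

/-- The regularization of a weak solution of the transport equation solves it along almost every
backward orbit. -/
theorem ae_solvesAlong_regularize [T2Space X] {m : Measure X} [SFinite m] [m.InnerRegular]
    (hE0 : ∀ x : X, IsOpen {t : ℝ | φ t x ∈ E0}) (hB : BorelGeometry φ E0)
    (hJ : IsCocycle φ J) (hm : HasFlowDensity φ J m) {f g : X → ℝ} (hf : Measurable f)
    (hg : Measurable g) (hfi : Integrable f m) (hgi : Integrable g m)
    (hweak : ∀ ψ, IsTestFun φ E0 ψ → ∫ x, g x * ψ x ∂m = ∫ x, f x * flowDeriv φ ψ x ∂m) :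
    ∀ᵐ y ∂m, SolvesAlong φ J E0 (regularize φ J f) g y := by
  have hall : ∀ᵐ y ∂m, ∀ τ h : ℚ, 0 ≤ τ → 0 ≤ h →
      (∀ s ∈ Icc 0 ((τ : ℝ) + h), φ (-s) y ∈ E0) →
      balance φ J f g y (τ + h) = balance φ J f g y τ + balance φ J f g y h := by
    refine ae_all_iff.2 fun τ => ae_all_iff.2 fun h => ae_all_iff.2 fun hτ =>
      ae_all_iff.2 fun hh => ?_
    have hτ' : (0 : ℝ) ≤ τ := by exact_mod_cast hτ
    have hh' : (0 : ℝ) ≤ h := by exact_mod_cast hh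
    exact ae_balance_add hJ hm hf hg hfi hgi hweak hτ' hh'
      (hB.measurableSet_backward hE0 (add_nonneg hτ' hh'))
  filter_upwards [hall, hm.ae_locallyIntegrable hJ hf hfi, hm.ae_locallyIntegrable hJ hg hgi]
    with y hadd hyf hyg u hu hmem
  have hif := intervalIntegrable_alongFlow_neg hyf
  have hig := intervalIntegrable_alongFlow_neg hyg
  -- Room beyond `u` is needed because the representative at `φ (-u) y` is read off from a right
  -- derivative at `u`.
  obtain ⟨b, hub, hb⟩ := exists_rat_forall_mem (isOpen_orbit_reverse hE0 (φ := φ)) hmem hu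
  have hb0 : 0 < b := by exact_mod_cast hu.trans_lt hub
  have hPc : Continuous (balance φ J f g y) :=
    (intervalIntegral.continuous_primitive hif 0).sub
      (continuous_iff_continuousAt.2 fun w => (hasDerivAt_integral_integral hig w).continuousAt)
  have hlin : ∀ w ∈ Icc 0 (b : ℝ), balance φ J f g y w = w * (balance φ J f g y b / b) :=
    fun w hw => eq_mul_div_of_rat_additive hPc hb0 (fun τ h hτ hh hτh =>
      hadd τ h hτ hh fun s hs => hb s ⟨hs.1, hs.2.trans (by exact_mod_cast hτh)⟩) hw
  set c := balance φ J f g y b / b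
  have hderiv : ∀ w ∈ Ico 0 (b : ℝ), alongFlow φ J (regularize φ J f) y (-w) =
      c + ∫ s in 0..w, alongFlow φ J g y (-s) := by
    intro w hw
    refine alongFlow_regularize hJ hyf ?_
    have hd : HasDerivAt (fun w => w * c + ∫ s in 0..w, (w - s) * alongFlow φ J g y (-s))
        (c + ∫ s in 0..w, alongFlow φ J g y (-s)) w := by
      have h1 : HasDerivAt (fun w : ℝ => w * c) c w := by
        simpa using (hasDerivAt_id w).mul_const c
      exact h1.add (hasDerivAt_integral_integral hig w)
    have heq : ∀ r ∈ Icc 0 (b : ℝ), ∫ s in 0..r, alongFlow φ J f y (-s) =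
        r * c + ∫ s in 0..r, (r - s) * alongFlow φ J g y (-s) := fun r hr => by
      rw [← hlin r hr, balance]; ring
    refine hd.hasDerivWithinAt.congr_of_eventuallyEq ?_ (heq w ⟨hw.1, hw.2.le⟩)
    filter_upwards [Ioo_mem_nhdsGT hw.2] with r hr
    exact heq r ⟨hw.1.trans hr.1.le, hr.2.le⟩
  have h0 := hderiv 0 ⟨le_rfl, hu.trans_lt hub⟩
  rw [neg_zero, alongFlow_zero hJ, intervalIntegral.integral_same, add_zero] at h0
  rw [hderiv u ⟨hu, hub⟩, h0]

/-- The transport equation along the backward orbits entails the one along the forward orbits. -/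
theorem ae_solvesAlong_reverse {m : Measure X} [SFinite m]
    (hE0 : ∀ x : X, IsOpen {t : ℝ | φ t x ∈ E0})
    (hJ : IsCocycle φ J) (hm : HasFlowDensity φ J m) {f g : X → ℝ}
    (hg : Measurable g) (hgi : Integrable g m) (h : ∀ᵐ y ∂m, SolvesAlong φ J E0 f g y) :
    ∀ᵐ y ∂m, SolvesAlong φ.reverse (fun t => J (-t)) E0 f (fun x => -g x) y := by
  have hall : ∀ᵐ y ∂m, ∀ ρ : ℚ, SolvesAlong φ J E0 f g (φ ρ y) :=
    ae_all_iff.2 fun ρ => hm.ae_flow ρ h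
  filter_upwards [hall, hm.ae_locallyIntegrable hJ hg hgi] with y hy hyg u hu hmem
  simp only [Flow.reverse_apply, neg_neg] at hmem
  obtain ⟨ρ, huρ, hρ⟩ := exists_rat_forall_mem hE0 hmem hu
  -- The backward equation started at `φ ρ y` and multiplied by `J ρ y` is an equation on the
  -- forward orbit of `y`. Rational `ρ` keep the exceptional set null; subtracting the cases `w = 0`
  -- and `w = u` removes `ρ`.
  have key : ∀ w : ℝ, 0 ≤ w → w ≤ ρ → alongFlow φ J f y w =
      alongFlow φ J f y ρ + ∫ s in w..ρ, alongFlow φ J g y s := by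
    intro w hw hwρ
    have h1 := hy ρ (ρ - w) (by linarith) fun s hs => by
      rw [← φ.map_add]
      exact hρ _ ⟨by linarith [hs.2], by linarith [hs.1]⟩
    have h2 := congrArg (· * J ρ y) h1
    simp only [add_mul, alongFlow_flow_mul hJ, ← intervalIntegral.integral_mul_const] at h2
    rw [neg_sub, sub_add_cancel] at h2
    have h3 := intervalIntegral.integral_comp_sub_left (a := 0) (b := (ρ : ℝ) - w)
      (fun s => alongFlow φ J g y s) ρ
    simp only [sub_sub_cancel, sub_zero] at h3
    simp only [neg_add_eq_sub] at h2
    rw [h2, h3, alongFlow]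
  have hi : ∀ a b : ℝ, IntervalIntegrable (alongFlow φ J g y) volume a b := fun a b =>
    (hyg.integrableOn_isCompact isCompact_uIcc).intervalIntegrable
  have k0 := key 0 le_rfl (hu.trans huρ.le)
  have ku := key u hu huρ.le
  rw [alongFlow_zero hJ, ← intervalIntegral.integral_add_adjacent_intervals (hi 0 u) (hi u ρ)] at k0
  simp only [alongFlow_reverse, neg_neg, alongFlow_neg, intervalIntegral.integral_neg]
  linarith

end SolvesAlong

/-! ### Primitives on the interval of times before the end of life. -/

section Lifetime

theorem exists_pos_coe_lt {T : EReal} (hT : 0 < T) : ∃ r : ℝ, 0 < r ∧ (r : EReal) < T := by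
  obtain ⟨r, h1, h2⟩ := EReal.lt_iff_exists_real_btwn.1 hT
  exact ⟨r, by exact_mod_cast h1, h2⟩

/-- The interval of the times before `T`. -/
def timesBefore (T : EReal) : Set ℝ := {s | 0 < s ∧ (s : EReal) < T}

theorem timesBefore_top : timesBefore ⊤ = Ioi 0 := by
  ext s; simp [timesBefore, EReal.coe_lt_top]

theorem timesBefore_coe (r : ℝ) : timesBefore r = Ioo 0 r := by
  ext s; simp [timesBefore]

theorem measurableSet_timesBefore (T : EReal) : MeasurableSet (timesBefore T) :=
  measurableSet_Ioi.inter (measurableSet_lt measurable_coe_real_ereal measurable_const)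

theorem Ioc_subset_timesBefore {T : EReal} {u : ℝ} (hu : u ∈ timesBefore T) :
    Ioc 0 u ⊆ timesBefore T := fun _ hs =>
  ⟨hs.1, lt_of_le_of_lt (by exact_mod_cast hs.2) hu.2⟩

theorem intervalIntegrable_of_timesBefore {T : EReal} {q : ℝ → ℝ}
    (hq : IntegrableOn q (timesBefore T)) {a b : ℝ} (ha : 0 ≤ a) (hb : 0 ≤ b)
    (haT : (a : EReal) < T) (hbT : (b : EReal) < T) : IntervalIntegrable q volume a b := by
  rw [intervalIntegrable_iff]
  refine hq.mono_set fun s hs => ?_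
  rw [uIoc, mem_Ioc] at hs
  refine ⟨lt_of_le_of_lt (le_min ha hb) hs.1, ?_⟩
  rcases le_max_iff.1 hs.2 with h | h
  · exact lt_of_le_of_lt (by exact_mod_cast h) haT
  · exact lt_of_le_of_lt (by exact_mod_cast h) hbT

theorem exists_of_ae_timesBefore {T : EReal} {Q : ℝ → Prop} (h : ∀ᵐ s : ℝ, s ∈ timesBefore T → Q s)
    {b : ℝ} (hb : b ∈ timesBefore T) : ∃ s ∈ Ioo 0 b, Q s := by
  have hne : (ae (volume.restrict (Ioo 0 b))).NeBot := by
    rw [ae_neBot, Ne, Measure.restrict_eq_zero, Real.volume_Ioo]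
    simpa using hb.1
  obtain ⟨s, hs, hsb⟩ := ((ae_restrict_of_ae (s := Ioo 0 b) h).and
    (ae_restrict_mem measurableSet_Ioo)).exists
  exact ⟨s, hsb, hs (Ioc_subset_timesBefore hb ⟨hsb.1, hsb.2.le⟩)⟩

/-- A function whose increments after almost every time are the integrals of an integrable
function `q`, is a primitive of `q`. -/
theorem exists_eq_add_integral {T : EReal} (hT : 0 < T) {p q : ℝ → ℝ}
    (hq : IntegrableOn q (timesBefore T))
    (h : ∀ᵐ s : ℝ, s ∈ timesBefore T → ∀ u, s ≤ u → u ∈ timesBefore T →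
      p u = p s + ∫ r in s..u, q r) :
    ∃ C, ∀ u ∈ timesBefore T, p u = C + ∫ r in 0..u, q r := by
  obtain ⟨b, hb⟩ := exists_pos_coe_lt hT
  refine ⟨p b - ∫ r in 0..b, q r, fun u hu => ?_⟩
  -- A good starting time below both `u` and the fixed `b` compares the two increments, so the
  -- constant does not depend on `u`.
  have hmin : min u b ∈ timesBefore T := by
    rcases min_choice u b with h' | h' <;> rw [h']
    exacts [hu, hb]
  obtain ⟨s, hs, hgood⟩ := exists_of_ae_timesBefore h hmin
  have hsT : (s : EReal) < T := lt_of_le_of_lt (by exact_mod_cast hs.2.le) hmin.2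
  have h1 := hgood u (hs.2.le.trans (min_le_left _ _)) hu
  have h2 := hgood b (hs.2.le.trans (min_le_right _ _)) hb
  have i1 : IntervalIntegrable q volume 0 s := intervalIntegrable_of_timesBefore hq le_rfl hs.1.le
    (by exact_mod_cast hT) hsT
  have i2 := intervalIntegrable_of_timesBefore hq hs.1.le hu.1.le hsT hu.2
  have i3 := intervalIntegrable_of_timesBefore hq hs.1.le hb.1.le hsT hb.2
  rw [← intervalIntegral.integral_add_adjacent_intervals i1 i2,
    ← intervalIntegral.integral_add_adjacent_intervals i1 i3]
  linarith

theorem tendsto_of_eq_add_integral {T : EReal} (hT : 0 < T) {p q : ℝ → ℝ}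
    (hq : IntegrableOn q (timesBefore T)) {C : ℝ}
    (h : ∀ u ∈ timesBefore T, p u = C + ∫ r in 0..u, q r) : Tendsto p (𝓝[>] 0) (𝓝 C) := by
  obtain ⟨b, hb⟩ := exists_pos_coe_lt hT
  have hi := intervalIntegrable_of_timesBefore hq le_rfl hb.1.le (by exact_mod_cast hT) hb.2
  have hc : ContinuousOn (fun u => ∫ r in 0..u, q r) (uIcc 0 b) :=
    intervalIntegral.continuousOn_primitive_interval'  hi left_mem_uIcc
  have h0 : Tendsto (fun u => C + ∫ r in 0..u, q r) (𝓝[>] 0) (𝓝 C) := by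
    have hle : 𝓝[>] (0 : ℝ) ≤ 𝓝[uIcc 0 b] 0 := nhdsWithin_le_of_mem (by
      rw [uIcc_of_le hb.1.le]; exact Icc_mem_nhdsGT hb.1)
    have := Tendsto.mono_left (hc 0 left_mem_uIcc) hle
    simpa using this.const_add C
  refine h0.congr' ?_
  filter_upwards [Ioc_mem_nhdsGT hb.1] with u hu
  exact (h u (Ioc_subset_timesBefore hb hu)).symm

/-- An integrable primitive of an integrable function vanishes at infinity. -/
theorem eq_neg_integral_Ioi {p q : ℝ → ℝ} (hp : IntegrableOn p (Ioi 0))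
    (hq : IntegrableOn q (Ioi 0)) {C : ℝ} (h : ∀ u, 0 < u → p u = C + ∫ r in 0..u, q r) :
    C = -∫ r in Ioi 0, q r := by
  have h1 : Tendsto (fun u => C + ∫ r in 0..u, q r) atTop (𝓝 (C + ∫ r in Ioi 0, q r)) :=
    (intervalIntegral_tendsto_integral_Ioi 0 hq tendsto_id).const_add C
  have h2 : Tendsto p atTop (𝓝 (C + ∫ r in Ioi 0, q r)) := by
    refine h1.congr' ?_
    filter_upwards [eventually_gt_atTop 0] with u hu using (h u hu).symm
  have hpi : IntegrableAtFilter p atTop := ⟨Ioi 0, Ioi_mem_atTop 0, hp⟩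
  -- The limit exists because `q` is integrable; it is zero because every neighbourhood of infinity
  -- has infinite length and `p` is integrable.
  have := hpi.eq_zero_of_tendsto (fun s hs => by
    obtain ⟨a, ha⟩ := mem_atTop_sets.1 hs
    exact top_le_iff.1 (Real.volume_Ici (a := a) ▸ measure_mono ha)) h2
  linarith

end Lifetime

/-! ### Backward orbits of outgoing boundary points. -/

section BackwardGeometry

variable {X : Type*} [TopologicalSpace X]

/-- The pairs of an outgoing boundary point and a time that is less than its backward lifetime. -/
def boundaryTimes (φ : Flow ℝ X) (E0 : Set X) : Set (X × ℝ) :=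
  {p | p.1 ∈ outBd φ E0 ∧ p.2 ∈ timesBefore (tMinus φ E0 p.1)}

/-- The points of `E0` whose orbits leave `E0`. -/
def leaving (φ : Flow ℝ X) (E0 : Set X) : Set X := E0 ∩ {x | tPlus φ E0 x < ⊤}

variable {φ : Flow ℝ X} {E0 : Set X}

theorem mem_inBd_reverse {z : X} (hz : z ∈ outBd φ E0) : z ∈ E0 ∪ inBd φ.reverse E0 :=
  .inr (by rwa [inBd_reverse])

theorem flow_neg_mem (hE0 : ∀ x : X, IsOpen {t : ℝ | φ t x ∈ E0}) {z : X} (hz : z ∈ outBd φ E0)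
    {s : ℝ} (hs : s ∈ timesBefore (tMinus φ E0 z)) : φ (-s) z ∈ E0 :=
  flow_mem_of_lt_tPlus (isOpen_orbit_reverse hE0) (mem_inBd_reverse hz) hs.1
    (by rw [tPlus_reverse]; exact hs.2)

theorem tMinus_pos (hE0 : ∀ x : X, IsOpen {t : ℝ | φ t x ∈ E0}) {z : X} (hz : z ∈ outBd φ E0) :
    0 < tMinus φ E0 z := by
  rw [← tPlus_reverse]
  exact tPlus_pos (isOpen_orbit_reverse hE0) (mem_inBd_reverse hz)

/-- The exit time of the points on the backward orbit of an outgoing boundary point. -/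
theorem tPlus_flow_neg (hE0 : ∀ x : X, IsOpen {t : ℝ | φ t x ∈ E0}) {z : X} (hz : z ∈ outBd φ E0)
    {s : ℝ} (hs : s ∈ timesBefore (tMinus φ E0 z)) : tPlus φ E0 (φ (-s) z) = s := by
  refine tPlus_eq_coe (.inl (flow_neg_mem hE0 hz hs)) hs.1 (fun r hr => ?_)
    (by rwa [flow_flow_neg])
  rw [← φ.map_add, show r + -s = -(s - r) by ring]
  exact flow_neg_mem hE0 hz (Ioc_subset_timesBefore hs ⟨by linarith [hr.2], by linarith [hr.1]⟩)

theorem mem_timesBefore_exit (hE0 : ∀ x : X, IsOpen {t : ℝ | φ t x ∈ E0}) {x : X} (hx : x ∈ E0)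
    (h : tPlus φ E0 x < ⊤) : (tPlus φ E0 x).toReal ∈
      timesBefore (tMinus φ E0 (φ (tPlus φ E0 x).toReal x)) := by
  have hpos := toReal_tPlus_pos hE0 (.inl hx) h
  refine ⟨hpos, ?_⟩
  rw [← tPlus_reverse, coe_lt_tPlus_iff (isOpen_orbit_reverse hE0)
    (mem_inBd_reverse (flow_toReal_tPlus_mem_outBd hE0 (.inl hx) h)) hpos]
  intro s hs
  rw [Flow.reverse_apply, ← φ.map_add]
  rcases hs.2.eq_or_lt with rfl | hlt
  · simpa using hx
  · refine flow_mem_of_lt_tPlus hE0 (.inl hx) (by linarith) ?_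
    rw [← coe_toReal_tPlus hE0 (.inl hx) h, EReal.toReal_coe]
    exact_mod_cast (by linarith [hs.1])

end BackwardGeometry

/-! ### Disintegration of `m` over the orbits through the boundary. -/

section Disintegration

variable {X : Type*} [TopologicalSpace X] [MeasurableSpace X]

/-- `μ` disintegrates `m` along the backward orbits of the outgoing boundary points. -/
structure Disintegrates (φ : Flow ℝ X) (E0 : Set X) (J : ℝ → X → ℝ) (m μ : Measure X) : Prop where
  concentrated : μ (outBd φ E0)ᶜ = 0
  restrict_eq : m.restrict (leaving φ E0) =
    (((μ.prod volume).restrict (boundaryTimes φ E0)).withDensity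
      (fun p => ENNReal.ofReal (J (-p.2) p.1))).map (fun p => φ (-p.2) p.1)

variable {φ : Flow ℝ X} {E0 : Set X} {J : ℝ → X → ℝ} {m μ : Measure X}

theorem BorelGeometry.measurableSet_leaving (hB : BorelGeometry φ E0) :
    MeasurableSet (leaving φ E0) := by
  obtain ⟨T, hT, hTeq⟩ := hB.exists_measurable_tPlus
  have : leaving φ E0 = E0 ∩ {x | T x < ⊤} := by
    ext x
    exact and_congr_right fun hx => by simp [hTeq x (.inl hx)]
  rw [this]
  exact hB.measurableSet_E0.inter (measurableSet_lt hT measurable_const)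

theorem BorelGeometry.measurableSet_boundaryTimes (hB : BorelGeometry φ E0) :
    MeasurableSet (boundaryTimes φ E0) := by
  obtain ⟨T, hT, hTeq⟩ := hB.reverse.exists_measurable_tPlus
  have : boundaryTimes φ E0 = Prod.fst ⁻¹' (outBd φ E0) ∩
      {p : X × ℝ | 0 < p.2 ∧ (p.2 : EReal) < T p.1} := by
    ext p
    refine and_congr_right fun hp => ?_
    simp [timesBefore, hTeq p.1 (mem_inBd_reverse hp), tPlus_reverse]
  rw [this]
  exact (measurable_fst hB.measurableSet_outBd).inter
    ((measurableSet_lt measurable_const measurable_snd).inter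
      (measurableSet_lt (measurable_coe_real_ereal.comp measurable_snd) (hT.comp measurable_fst)))

namespace Disintegrates

theorem ae_mem (h : Disintegrates φ E0 J m μ) : ∀ᵐ z ∂μ, z ∈ outBd φ E0 := h.concentrated

theorem indicator_ae_eq (h : Disintegrates φ E0 J m μ) {α : Type*} [Zero α] (w : X × ℝ → α) :
    ∀ᵐ z ∂μ, (fun s => (boundaryTimes φ E0).indicator w (z, s)) =
      (timesBefore (tMinus φ E0 z)).indicator fun s => w (z, s) := by
  filter_upwards [h.ae_mem] with z hz
  funext s
  by_cases hs : s ∈ timesBefore (tMinus φ E0 z)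
  · rw [indicator_of_mem hs, indicator_of_mem (show (z, s) ∈ boundaryTimes φ E0 from ⟨hz, hs⟩)]
  · rw [indicator_of_notMem hs, indicator_of_notMem fun hmem => hs hmem.2]

theorem measurable_density (hJ : IsCocycle φ J) :
    Measurable (fun p : X × ℝ => ENNReal.ofReal (J (-p.2) p.1)) :=
  (hJ.measurable.comp (measurable_snd.neg.prodMk measurable_fst)).ennreal_ofReal

end Disintegrates

variable [SecondCountableTopology X] [BorelSpace X]

/-- On `E0` the map `w₊` is inverted by `(s, z) ↦ φ_{-s}(z)`. The set `S` is left free because the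
definition of `stateSp` is not symmetric under time reversal, while both boundaries use the same
`E`; points of `S` outside `E0` play no role, since `w₊(x) ∈ W₊` forces `x ∈ E0`. -/
theorem disintegrates_of_map_eq [SFinite μ] (hE0 : ∀ x : X, IsOpen {t : ℝ | φ t x ∈ E0})
    (hB : BorelGeometry φ E0) (hJ : IsCocycle φ J) (hμ : μ (outBd φ E0)ᶜ = 0)
    {S : Set X} (hS : E0 ⊆ S)
    (h : ∀ F : Set (ℝ × X), MeasurableSet F → F ⊆ WPlus φ E0 →
      m {x | (x ∈ S ∧ 0 < tPlus φ E0 x ∧ tPlus φ E0 x < ⊤) ∧ wPlus φ E0 x ∈ F} =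
      ∫⁻ z, (∫⁻ s : ℝ, F.indicator (fun p => ENNReal.ofReal (J (-p.1) p.2)) (s, z)) ∂μ) :
    Disintegrates φ E0 J m μ := by
  refine ⟨hμ, ?_⟩
  have hΦ : Measurable (fun p : X × ℝ => φ (-p.2) p.1) :=
    (measurable_flow φ).comp (measurable_snd.neg.prodMk measurable_fst)
  have hJm : Measurable (fun p : X × ℝ => ENNReal.ofReal (J (-p.2) p.1)) :=
    (hJ.measurable.comp (measurable_snd.neg.prodMk measurable_fst)).ennreal_ofReal
  ext A hA
  rw [Measure.restrict_apply hA, Measure.map_apply hΦ hA, withDensity_apply _ (hΦ hA),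
    Measure.restrict_restrict (hΦ hA)]
  set V := (fun p : X × ℝ => φ (-p.2) p.1) ⁻¹' A ∩ boundaryTimes φ E0 with hV
  have hVm : MeasurableSet V := (hΦ hA).inter hB.measurableSet_boundaryTimes
  have hF := h (Prod.swap ⁻¹' V) (measurable_swap hVm)
    fun p hp => ⟨hp.2.2.1, hp.2.2.2, hp.2.1⟩
  have hset : {x | (x ∈ S ∧ 0 < tPlus φ E0 x ∧ tPlus φ E0 x < ⊤) ∧
      wPlus φ E0 x ∈ Prod.swap ⁻¹' V} = A ∩ leaving φ E0 := by
    ext x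
    constructor
    · rintro ⟨⟨-, -, hlt⟩, hxA, hout, hs⟩
      have hx : x ∈ E0 := by
        have := flow_neg_mem hE0 hout hs
        simpa [wPlus, flow_neg_flow] using this
      exact ⟨by simpa [wPlus, flow_neg_flow] using hxA, hx, hlt⟩
    · rintro ⟨hxA, hx, hlt⟩
      refine ⟨⟨hS hx, tPlus_pos hE0 (.inl hx), hlt⟩, ?_, ?_, ?_⟩
      · simpa [wPlus, flow_neg_flow] using hxA
      · exact flow_toReal_tPlus_mem_outBd hE0 (.inl hx) hlt
      · exact mem_timesBefore_exit hE0 hx hlt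
  rw [← hset, hF, ← lintegral_indicator hVm, lintegral_prod _ (hJm.indicator hVm).aemeasurable]
  rfl

theorem IsOutMeasure.disintegrates [SFinite μ] (hE0 : ∀ x : X, IsOpen {t : ℝ | φ t x ∈ E0})
    (hB : BorelGeometry φ E0) (hJ : IsCocycle φ J) (h : IsOutMeasure φ E0 J m μ) :
    Disintegrates φ E0 J m μ :=
  disintegrates_of_map_eq hE0 hB hJ h.concentrated subset_stateSp h.map_eq

theorem IsInMeasure.disintegrates [SFinite μ] (hE0 : ∀ x : X, IsOpen {t : ℝ | φ t x ∈ E0})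
    (hB : BorelGeometry φ E0) (hJ : IsCocycle φ J) (h : IsInMeasure φ E0 J m μ) :
    Disintegrates φ.reverse E0 (fun t => J (-t)) m μ := by
  refine disintegrates_of_map_eq (isOpen_orbit_reverse hE0) hB.reverse hJ.reverse
    h.concentrated (S := stateSp φ E0) subset_stateSp fun F hF hFW => ?_
  have hW : WPlus φ.reverse E0 = WMinus φ E0 := by
    simp only [WPlus, WMinus, tMinus_reverse, outBd_reverse]
  have := h.map_eq F hF (hW ▸ hFW)
  simp only [EMinus, wMinus, mem_ofPred_eq] at this
  simp only [tPlus_reverse, wPlus, Flow.reverse_apply, neg_neg]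
  exact this

namespace Disintegrates

theorem measurable_backward (φ : Flow ℝ X) : Measurable (fun p : X × ℝ => φ (-p.2) p.1) :=
  (measurable_flow φ).comp (measurable_snd.neg.prodMk measurable_fst)

/-- A property that holds almost everywhere in `E0` holds at almost all times on almost every orbit
through the outgoing boundary. -/
theorem ae_ae (h : Disintegrates φ E0 J m μ) (hB : BorelGeometry φ E0) (hJ : IsCocycle φ J)
    {Q : X → Prop} (hQ : ∀ᵐ x ∂m, x ∈ E0 → Q x) :
    ∀ᵐ z ∂μ, ∀ᵐ s : ℝ, s ∈ timesBefore (tMinus φ E0 z) → Q (φ (-s) z) := by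
  have h1 : ∀ᵐ x ∂(m.restrict (leaving φ E0)), Q x := by
    filter_upwards [ae_restrict_of_ae hQ, ae_restrict_mem hB.measurableSet_leaving] with x h1 h2
    exact h1 h2.1
  rw [h.restrict_eq] at h1
  have h2 := ae_of_ae_map (measurable_backward φ).aemeasurable h1
  rw [ae_withDensity_iff (measurable_density hJ), ae_restrict_iff'
    hB.measurableSet_boundaryTimes] at h2
  filter_upwards [Measure.ae_ae_of_ae_prod h2, h.ae_mem] with z hz hzout
  filter_upwards [hz] with s hs hsT
  exact hs ⟨hzout, hsT⟩ (by simpa using hJ.pos _ _)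

theorem integrable_indicator (h : Disintegrates φ E0 J m μ) (hB : BorelGeometry φ E0)
    (hJ : IsCocycle φ J) {v : X → ℝ} (hv : Measurable v) (hvi : Integrable v m) :
    Integrable ((boundaryTimes φ E0).indicator fun p => alongFlow φ J v p.1 (-p.2))
      (μ.prod volume) := by
  have h1 : Integrable v (m.restrict (leaving φ E0)) := hvi.restrict
  rw [h.restrict_eq, integrable_map_measure hv.aestronglyMeasurable
    (measurable_backward φ).aemeasurable, integrable_withDensity_iff (measurable_density hJ)
    (by simp)] at h1
  rw [integrable_indicator_iff hB.measurableSet_boundaryTimes]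
  simpa [ENNReal.toReal_ofReal (hJ.nonneg _ _), IntegrableOn, alongFlow] using h1

theorem ae_integrableOn [SFinite μ] (h : Disintegrates φ E0 J m μ) (hB : BorelGeometry φ E0)
    (hJ : IsCocycle φ J) {v : X → ℝ} (hv : Measurable v) (hvi : Integrable v m) :
    ∀ᵐ z ∂μ, IntegrableOn (fun s => alongFlow φ J v z (-s)) (timesBefore (tMinus φ E0 z)) := by
  filter_upwards [(h.integrable_indicator hB hJ hv hvi).prod_right_ae,
    h.indicator_ae_eq fun p => alongFlow φ J v p.1 (-p.2)] with z hz heq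
  rwa [heq, integrable_indicator_iff (measurableSet_timesBefore _)] at hz

theorem integrable_integral (h : Disintegrates φ E0 J m μ) (hB : BorelGeometry φ E0)
    (hJ : IsCocycle φ J) {v : X → ℝ} (hv : Measurable v) (hvi : Integrable v m) :
    Integrable (fun z => ∫ s in timesBefore (tMinus φ E0 z), alongFlow φ J v z (-s)) μ := by
  refine (h.integrable_indicator hB hJ hv hvi).integral_prod_left.congr ?_
  filter_upwards [h.indicator_ae_eq fun p => alongFlow φ J v p.1 (-p.2)] with z heq
  rw [heq, integral_indicator (measurableSet_timesBefore _)]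

theorem integral_leaving [SFinite μ] (h : Disintegrates φ E0 J m μ) (hB : BorelGeometry φ E0)
    (hJ : IsCocycle φ J) {v : X → ℝ} (hv : Measurable v) (hvi : Integrable v m) :
    ∫ x in leaving φ E0, v x ∂m =
      ∫ z, (∫ s in timesBefore (tMinus φ E0 z), alongFlow φ J v z (-s)) ∂μ := by
  have hi := h.integrable_indicator hB hJ hv hvi
  rw [h.restrict_eq, integral_map (measurable_backward φ).aemeasurable hv.aestronglyMeasurable,
    integral_withDensity_eq_integral_toReal_smul (measurable_density hJ) (by simp)]
  have : ∀ p : X × ℝ, (ENNReal.ofReal (J (-p.2) p.1)).toReal • v (φ (-p.2) p.1) =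
      alongFlow φ J v p.1 (-p.2) := fun p => by
    rw [ENNReal.toReal_ofReal (hJ.nonneg _ _), smul_eq_mul, mul_comm, alongFlow]
  simp only [this]
  rw [← integral_indicator hB.measurableSet_boundaryTimes, integral_prod _ hi]
  refine integral_congr_ae ?_
  filter_upwards [h.indicator_ae_eq fun p => alongFlow φ J v p.1 (-p.2)] with z heq
  rw [heq, integral_indicator (measurableSet_timesBefore _)]

theorem lintegral_leaving (h : Disintegrates φ E0 J m μ) (hB : BorelGeometry φ E0)
    (hJ : IsCocycle φ J) {v : X → ENNReal} (hv : Measurable v) :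
    ∫⁻ x in leaving φ E0, v x ∂m = ∫⁻ z, (∫⁻ s in timesBefore (tMinus φ E0 z),
      ENNReal.ofReal (J (-s) z) * v (φ (-s) z)) ∂μ := by
  have hm' := (measurable_density hJ).mul (hv.comp (measurable_backward φ))
  have hwd := lintegral_withDensity_eq_lintegral_mul
    ((μ.prod volume).restrict (boundaryTimes φ E0)) (measurable_density hJ)
    (hv.comp (measurable_backward φ))
  simp only [Function.comp_apply] at hwd
  rw [h.restrict_eq, lintegral_map hv (measurable_backward φ), hwd, ← lintegral_indicator hB.measurableSet_boundaryTimes,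
    lintegral_prod _ (hm'.indicator hB.measurableSet_boundaryTimes).aemeasurable]
  refine lintegral_congr_ae ?_
  filter_upwards [h.indicator_ae_eq ((fun p : X × ℝ => ENNReal.ofReal (J (-p.2) p.1)) *
    fun p : X × ℝ => v (φ (-p.2) p.1))] with z heq
  have heq' := fun s => congrFun heq s
  calc _ = ∫⁻ s, (timesBefore (tMinus φ E0 z)).indicator
        (fun s => ENNReal.ofReal (J (-s) z) * v (φ (-s) z)) s := lintegral_congr heq'
    _ = _ := lintegral_indicator (measurableSet_timesBefore _) _

end Disintegrates

end Disintegration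

/-! ### Existence, uniqueness and measurability of the traces. -/

namespace Disintegrates

variable {X : Type*} [TopologicalSpace X] [SecondCountableTopology X] [MeasurableSpace X]
  [BorelSpace X] {φ : Flow ℝ X} {E0 : Set X} {J : ℝ → X → ℝ} {m μ : Measure X}

/-- A solution of the transport equation is a primitive on almost every orbit through the outgoing
boundary. -/
theorem ae_exists_eq_add_integral [SFinite μ] (h : Disintegrates φ E0 J m μ)
    (hE0 : ∀ x : X, IsOpen {t : ℝ | φ t x ∈ E0}) (hB : BorelGeometry φ E0) (hJ : IsCocycle φ J)
    {f g : X → ℝ} (hg : Measurable g) (hgi : Integrable g m)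
    (hsol : ∀ᵐ y ∂m, SolvesAlong φ J E0 f g y) :
    ∀ᵐ z ∂μ, ∃ C, ∀ u ∈ timesBefore (tMinus φ E0 z),
      alongFlow φ J f z (-u) = C + ∫ r in 0..u, alongFlow φ J g z (-r) := by
  filter_upwards [h.ae_mem, h.ae_integrableOn hB hJ hg hgi,
    h.ae_ae hB hJ (hsol.mono fun y hy _ => hy)] with z hz hgz hsolz
  refine exists_eq_add_integral (p := fun u => alongFlow φ J f z (-u)) (tMinus_pos hE0 hz) hgz ?_
  -- The disintegration controls only almost every time `s`, but the equation started at `φ (-s) z`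
  -- yields all increments beyond `s`.
  filter_upwards [hsolz] with s hs hsT u hsu hu
  have h1 := hs hsT (u - s) (by linarith) fun r hr => by
    rw [← φ.map_add]
    rw [show -r + -s = -(r + s) by ring]
    exact flow_neg_mem hE0 hz (Ioc_subset_timesBefore hu
      ⟨by linarith [hr.1, hsT.1], by linarith [hr.2]⟩)
  have h2 := congrArg (· * J (-s) z) h1
  simp only [add_mul, alongFlow_flow_mul hJ, ← intervalIntegral.integral_mul_const] at h2
  have h3 := intervalIntegral.integral_comp_add_right (a := 0) (b := u - s)
    (fun r => alongFlow φ J g z (-r)) s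
  simp only [neg_add, zero_add, sub_add_cancel] at h3
  rw [h3, show -(u - s) + -s = -u by ring] at h2
  exact h2

theorem ae_exists_tendsto [SFinite μ] (h : Disintegrates φ E0 J m μ)
    (hE0 : ∀ x : X, IsOpen {t : ℝ | φ t x ∈ E0}) (hB : BorelGeometry φ E0) (hJ : IsCocycle φ J)
    {f g : X → ℝ} (hg : Measurable g) (hgi : Integrable g m)
    (hsol : ∀ᵐ y ∂m, SolvesAlong φ J E0 f g y) :
    ∀ᵐ z ∂μ, ∃ C, Tendsto (fun s => alongFlow φ J f z (-s)) (𝓝[>] 0) (𝓝 C) := by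
  filter_upwards [h.ae_mem, h.ae_integrableOn hB hJ hg hgi,
    h.ae_exists_eq_add_integral hE0 hB hJ hg hgi hsol] with z hz hgz hC
  obtain ⟨C, hC⟩ := hC
  exact ⟨C, tendsto_of_eq_add_integral (tMinus_pos hE0 hz) hgz hC⟩

theorem ae_eq_trace_add_integral [SFinite μ] (h : Disintegrates φ E0 J m μ)
    (hE0 : ∀ x : X, IsOpen {t : ℝ | φ t x ∈ E0}) (hB : BorelGeometry φ E0) (hJ : IsCocycle φ J)
    {f g γ : X → ℝ} (hg : Measurable g) (hgi : Integrable g m)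
    (hsol : ∀ᵐ y ∂m, SolvesAlong φ J E0 f g y)
    (hγ : ∀ᵐ z ∂μ, Tendsto (fun s => alongFlow φ J f z (-s)) (𝓝[>] 0) (𝓝 (γ z))) :
    ∀ᵐ z ∂μ, ∀ u ∈ timesBefore (tMinus φ E0 z),
      alongFlow φ J f z (-u) = γ z + ∫ r in 0..u, alongFlow φ J g z (-r) := by
  filter_upwards [h.ae_mem, h.ae_integrableOn hB hJ hg hgi,
    h.ae_exists_eq_add_integral hE0 hB hJ hg hgi hsol, hγ] with z hz hgz hC hγz
  obtain ⟨C, hC⟩ := hC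
  rwa [tendsto_nhds_unique hγz (tendsto_of_eq_add_integral (tMinus_pos hE0 hz) hgz hC)]

/-- The trace does not depend on the representative. -/
theorem ae_tendsto_of_ae_eq (h : Disintegrates φ E0 J m μ)
    (hE0 : ∀ x : X, IsOpen {t : ℝ | φ t x ∈ E0}) (hB : BorelGeometry φ E0) (hJ : IsCocycle φ J)
    {f f' γ : X → ℝ} (hff' : ∀ᵐ x ∂m, x ∈ E0 → f' x = f x)
    (hex : ∀ᵐ z ∂μ, ∃ C, Tendsto (fun s => alongFlow φ J f z (-s)) (𝓝[>] 0) (𝓝 C))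
    (hγ : ∀ᵐ z ∂μ, Tendsto (fun s => alongFlow φ J f' z (-s)) (𝓝[>] 0) (𝓝 (γ z))) :
    ∀ᵐ z ∂μ, Tendsto (fun s => alongFlow φ J f z (-s)) (𝓝[>] 0) (𝓝 (γ z)) := by
  filter_upwards [h.ae_mem, hex, hγ, h.ae_ae hB hJ hff'] with z hz hC hγz hae
  obtain ⟨C, hC⟩ := hC
  -- Both limits are known to exist, so agreement at arbitrarily small times, which follows from
  -- agreement at almost all times, is enough.
  have hfreq : ∃ᶠ s in 𝓝[>] (0 : ℝ), alongFlow φ J f z (-s) = alongFlow φ J f' z (-s) := by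
    rw [frequently_iff]
    intro U hU
    obtain ⟨ε, hε, hεU⟩ := mem_nhdsGT_iff_exists_Ioo_subset.1 hU
    obtain ⟨b, hb⟩ := exists_pos_coe_lt (tMinus_pos hE0 hz)
    have hmin : min b ε ∈ timesBefore (tMinus φ E0 z) :=
      Ioc_subset_timesBefore hb ⟨lt_min hb.1 hε, min_le_left _ _⟩
    obtain ⟨s, hs, hgood⟩ := exists_of_ae_timesBefore hae hmin
    exact ⟨s, hεU ⟨hs.1, hs.2.trans_le (min_le_right _ _)⟩, by rw [alongFlow, alongFlow, hgood]⟩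
  rwa [tendsto_nhds_unique_of_frequently_eq hγz hC (hfreq.mono fun s hs => hs.symm)]

/-- A trace is only given as a pointwise limit; along the times `1 / (n + 1)` it is an almost
everywhere limit of Borel functions. -/
theorem aestronglyMeasurable_trace (hJ : IsCocycle φ J) {f γ : X → ℝ} (hf : Measurable f)
    (hγ : ∀ᵐ z ∂μ, Tendsto (fun s => alongFlow φ J f z (-s)) (𝓝[>] 0) (𝓝 (γ z))) :
    AEStronglyMeasurable γ μ := by
  have hlim : Tendsto (fun n : ℕ => 1 / ((n : ℝ) + 1)) atTop (𝓝[>] 0) :=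
    tendsto_nhdsWithin_iff.2 ⟨tendsto_one_div_add_atTop_nhds_zero_nat,
      Eventually.of_forall fun n => by simp only [mem_Ioi]; positivity⟩
  refine aestronglyMeasurable_of_tendsto_ae atTop
    (f := fun (n : ℕ) z => alongFlow φ J f z (-(1 / ((n : ℝ) + 1)))) (fun n => ?_)
    (hγ.mono fun z hz => hz.comp hlim)
  exact ((measurable_alongFlow hJ hf).comp
    (measurable_const.prodMk measurable_id)).aestronglyMeasurable

end Disintegrates

/-! ### Orbits of infinite lifetime. -/

section Green

variable {X : Type*} [TopologicalSpace X] {φ : Flow ℝ X} {E0 : Set X}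

theorem tPlus_eq_top_iff (hE0 : ∀ x : X, IsOpen {t : ℝ | φ t x ∈ E0}) {x : X}
    (hx : x ∈ E0 ∪ inBd φ E0) : tPlus φ E0 x = ⊤ ↔ ∀ r : ℝ, 0 < r → φ r x ∈ E0 := by
  refine ⟨fun h r hr => flow_mem_of_lt_tPlus hE0 hx hr (h ▸ EReal.coe_lt_top r), fun h => ?_⟩
  by_contra hne
  have hlt := lt_top_iff_ne_top.2 hne
  exact notMem_of_mem_outBd (flow_toReal_tPlus_mem_outBd hE0 hx hlt)
    (h _ (toReal_tPlus_pos hE0 hx hlt))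

theorem tMinus_eq_top_iff (hE0 : ∀ x : X, IsOpen {t : ℝ | φ t x ∈ E0}) {x : X}
    (hx : x ∈ E0 ∪ outBd φ E0) : tMinus φ E0 x = ⊤ ↔ ∀ r : ℝ, 0 < r → φ (-r) x ∈ E0 := by
  rw [← tPlus_reverse]
  exact tPlus_eq_top_iff (isOpen_orbit_reverse hE0) (by rwa [inBd_reverse])

theorem tMinus_flow_neg_eq_top_iff (hE0 : ∀ x : X, IsOpen {t : ℝ | φ t x ∈ E0}) {z : X}
    (hz : z ∈ outBd φ E0) {s : ℝ} (hs : s ∈ timesBefore (tMinus φ E0 z)) :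
    tMinus φ E0 (φ (-s) z) = ⊤ ↔ tMinus φ E0 z = ⊤ := by
  rw [tMinus_eq_top_iff hE0 (.inl (flow_neg_mem hE0 hz hs)), tMinus_eq_top_iff hE0 (.inr hz)]
  simp only [← φ.map_add]
  constructor
  · intro h r hr
    rcases le_or_gt r s with hrs | hrs
    · exact flow_neg_mem hE0 hz (Ioc_subset_timesBefore hs ⟨hr, hrs⟩)
    · have := h (r - s) (by linarith)
      rwa [show -(r - s) + -s = -r by ring] at this
  · intro h r hr
    rw [show -r + -s = -(r + s) by ring]
    exact h _ (by linarith [hs.1])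

/-- The backward lifetime of the points on the backward orbit of an outgoing boundary point. -/
theorem tMinus_flow_neg (hE0 : ∀ x : X, IsOpen {t : ℝ | φ t x ∈ E0}) {z : X}
    (hz : z ∈ outBd φ E0) {ℓ s : ℝ} (hℓ : tMinus φ E0 z = ℓ) (hs : s ∈ Ioo 0 ℓ) :
    tMinus φ E0 (φ (-s) z) = (ℓ - s : ℝ) := by
  have hsub : ∀ r ∈ Ioo 0 ℓ, φ (-r) z ∈ E0 := fun r hr =>
    flow_neg_mem hE0 hz (by rw [hℓ, timesBefore_coe]; exact hr)
  rw [← tPlus_reverse]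
  refine tPlus_eq_coe (.inl (hsub s hs)) (by linarith [hs.2]) (fun r hr => ?_) ?_
  · rw [Flow.reverse_apply, ← φ.map_add, show -r + -s = -(r + s) by ring]
    exact hsub _ ⟨by linarith [hr.1, hs.1], by linarith [hr.2]⟩
  · have hlt : tPlus φ.reverse E0 z < ⊤ := by rw [tPlus_reverse, hℓ]; exact EReal.coe_lt_top ℓ
    have := flow_toReal_tPlus_mem_outBd (isOpen_orbit_reverse hE0) (mem_inBd_reverse hz) hlt
    rw [tPlus_reverse, hℓ, EReal.toReal_coe] at this
    rw [Flow.reverse_apply, ← φ.map_add, show -(ℓ - s) + -s = -ℓ by ring]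
    exact this

variable [SecondCountableTopology X] [MeasurableSpace X] [BorelSpace X]
  {J : ℝ → X → ℝ} {m μ : Measure X}

/-- The trace at the end of an orbit of infinite backward lifetime. -/
theorem Disintegrates.ae_trace_eq_neg_integral [SFinite μ] (h : Disintegrates φ E0 J m μ)
    (hE0 : ∀ x : X, IsOpen {t : ℝ | φ t x ∈ E0}) (hB : BorelGeometry φ E0) (hJ : IsCocycle φ J)
    {f g γ : X → ℝ} (hf : Measurable f) (hg : Measurable g) (hfi : Integrable f m)
    (hgi : Integrable g m) (hsol : ∀ᵐ y ∂m, SolvesAlong φ J E0 f g y)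
    (hγ : ∀ᵐ z ∂μ, Tendsto (fun s => alongFlow φ J f z (-s)) (𝓝[>] 0) (𝓝 (γ z))) :
    ∀ᵐ z ∂μ, tMinus φ E0 z = ⊤ →
      γ z = -∫ s in timesBefore (tMinus φ E0 z), alongFlow φ J g z (-s) := by
  filter_upwards [h.ae_integrableOn hB hJ hf hfi, h.ae_integrableOn hB hJ hg hgi,
    h.ae_eq_trace_add_integral hE0 hB hJ hg hgi hsol hγ] with z hfz hgz hz htop
  have hT : timesBefore (tMinus φ E0 z) = Ioi 0 := by rw [htop, timesBefore_top]
  rw [hT] at hfz hgz hz ⊢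
  exact eq_neg_integral_Ioi hfz hgz hz

end Green

/-! ### Chords from `Γ⁻` to `Γ⁺` and the exit map. -/

section Chords

variable {X : Type*} [TopologicalSpace X]

/-- The outgoing boundary points of finite backward lifetime. -/
def finiteOut (φ : Flow ℝ X) (E0 : Set X) : Set X := outBd φ E0 ∩ {z | tMinus φ E0 z < ⊤}

/-- The points of `E0` on the orbit pieces that enter and leave `E0`. -/
def traversing (φ : Flow ℝ X) (E0 : Set X) : Set X := leaving φ E0 ∩ leaving φ.reverse E0

theorem traversing_reverse (φ : Flow ℝ X) (E0 : Set X) :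
    traversing φ.reverse E0 = traversing φ E0 := by
  simp only [traversing, leaving, tPlus_reverse, tMinus_reverse]
  exact inter_comm _ _

variable {φ : Flow ℝ X} {E0 : Set X}

theorem mem_traversing {x : X} (hx : x ∈ E0) (h1 : tPlus φ E0 x < ⊤) (h2 : tMinus φ E0 x < ⊤) :
    x ∈ traversing φ E0 :=
  ⟨⟨hx, h1⟩, hx, by rw [mem_ofPred_eq, tPlus_reverse]; exact h2⟩

theorem exists_coe_eq_tMinus (hE0 : ∀ x : X, IsOpen {t : ℝ | φ t x ∈ E0}) {z : X}
    (hz : z ∈ finiteOut φ E0) : ∃ ℓ : ℝ, 0 < ℓ ∧ tMinus φ E0 z = ℓ := by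
  have hlt : tPlus φ.reverse E0 z < ⊤ := by rw [tPlus_reverse]; exact hz.2
  refine ⟨(tPlus φ.reverse E0 z).toReal,
    toReal_tPlus_pos (isOpen_orbit_reverse hE0) (mem_inBd_reverse hz.1) hlt, ?_⟩
  rw [coe_toReal_tPlus (isOpen_orbit_reverse hE0) (mem_inBd_reverse hz.1) hlt, tPlus_reverse]

variable [MeasurableSpace X]

theorem BorelGeometry.measurableSet_finiteOut (hB : BorelGeometry φ E0) :
    MeasurableSet (finiteOut φ E0) := by
  obtain ⟨T, hT, hTeq⟩ := hB.reverse.exists_measurable_tPlus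
  have : finiteOut φ E0 = outBd φ E0 ∩ {z | T z < ⊤} := by
    ext z
    refine and_congr_right fun hz => ?_
    simp [hTeq z (mem_inBd_reverse hz), tPlus_reverse]
  rw [this]
  exact hB.measurableSet_outBd.inter (measurableSet_lt hT measurable_const)

theorem BorelGeometry.measurableSet_traversing (hB : BorelGeometry φ E0) :
    MeasurableSet (traversing φ E0) :=
  hB.measurableSet_leaving.inter hB.reverse.measurableSet_leaving

variable [SecondCountableTopology X] [BorelSpace X] {J : ℝ → X → ℝ} {m μ : Measure X}

/-- The integral of a function over the points on the traversing orbits, if the function is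
constant along these orbits after multiplication by the density. -/
theorem Disintegrates.lintegral_traversing [SFinite μ] (h : Disintegrates φ E0 J m μ)
    (hE0 : ∀ x : X, IsOpen {t : ℝ | φ t x ∈ E0}) (hB : BorelGeometry φ E0) (hJ : IsCocycle φ J)
    {v w : X → ENNReal} (hv : Measurable v)
    (hvw : ∀ z ∈ outBd φ E0, ∀ ℓ : ℝ, tMinus φ E0 z = ℓ → ∀ s ∈ Ioo 0 ℓ,
      ENNReal.ofReal (J (-s) z) * v (φ (-s) z) = w z / ENNReal.ofReal ℓ) :
    ∫⁻ x in traversing φ E0, v x ∂m = ∫⁻ z in finiteOut φ E0, w z ∂μ := by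
  have hT := hB.measurableSet_traversing
  have h1 : ∫⁻ x in traversing φ E0, v x ∂m =
      ∫⁻ x in leaving φ E0, (traversing φ E0).indicator v x ∂m := by
    rw [setLIntegral_indicator hT, traversing, inter_right_comm, inter_self]
  rw [h1, h.lintegral_leaving hB hJ (hv.indicator hT),
    ← lintegral_indicator hB.measurableSet_finiteOut]
  refine lintegral_congr_ae ?_
  filter_upwards [h.ae_mem] with z hz
  by_cases hfin : z ∈ finiteOut φ E0
  · obtain ⟨ℓ, hℓ0, hℓ⟩ := exists_coe_eq_tMinus hE0 hfin
    rw [indicator_of_mem hfin, hℓ, timesBefore_coe]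
    have : ∀ s ∈ Ioo 0 ℓ, ENNReal.ofReal (J (-s) z) *
        (traversing φ E0).indicator v (φ (-s) z) = w z / ENNReal.ofReal ℓ := by
      intro s hs
      have hs' : s ∈ timesBefore (tMinus φ E0 z) := by rwa [hℓ, timesBefore_coe]
      rw [indicator_of_mem, hvw z hz ℓ hℓ s hs]
      refine mem_traversing (flow_neg_mem hE0 hz hs') ?_ ?_
      · rw [tPlus_flow_neg hE0 hz hs']; exact EReal.coe_lt_top s
      · rw [tMinus_flow_neg hE0 hz hℓ hs]; exact EReal.coe_lt_top _
    -- The integrand is constant on a chord of length `ℓ`, so the division by `ℓ` in `hvw` leaves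
    -- exactly `w z`.
    rw [setLIntegral_congr_fun measurableSet_Ioo this, setLIntegral_const, Real.volume_Ioo,
      sub_zero, ENNReal.div_mul_cancel (by simpa using hℓ0) ENNReal.ofReal_ne_top]
  · rw [indicator_of_notMem hfin]
    have htop : tMinus φ E0 z = ⊤ := by
      by_contra hne
      exact hfin ⟨hz, lt_top_iff_ne_top.2 hne⟩
    rw [setLIntegral_congr_fun (measurableSet_timesBefore _) (g := fun _ => 0), lintegral_zero]
    intro s hs
    simp only
    rw [indicator_of_notMem, mul_zero]
    intro hmem
    have := hmem.2.2
    rw [mem_ofPred_eq, tPlus_reverse, (tMinus_flow_neg_eq_top_iff hE0 hz hs).2 htop] at this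
    exact lt_irrefl _ this

/-- The measures on the incoming and on the outgoing boundary are related through the map which
sends an incoming boundary point to the exit point of its orbit. -/
theorem lintegral_finiteOut_eq {mp mm : Measure X} [SFinite mp] [SFinite mm]
    (hp : Disintegrates φ E0 J m mp) (hn : Disintegrates φ.reverse E0 (fun t => J (-t)) m mm)
    (hE0 : ∀ x : X, IsOpen {t : ℝ | φ t x ∈ E0}) (hB : BorelGeometry φ E0) (hJ : IsCocycle φ J)
    {T : X → EReal} (hT : Measurable T) (hTeq : ∀ x ∈ E0 ∪ inBd φ E0, T x = tPlus φ E0 x)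
    {k : X → ENNReal} (hk : Measurable k) :
    ∫⁻ z in finiteOut φ E0, k z ∂mp = ∫⁻ z in finiteOut φ.reverse E0,
      ENNReal.ofReal (J (T z).toReal z) * k (φ (T z).toReal z) ∂mm := by
  obtain ⟨S, hS, hSeq⟩ := hB.reverse.exists_measurable_tPlus
  have hSeq' : ∀ x ∈ E0, S x = tMinus φ E0 x := fun x hx => by
    rw [hSeq x (.inl hx), tPlus_reverse]
  have hTr : Measurable fun x => (T x).toReal := measurable_ereal_toReal.comp hT
  have hSr : Measurable fun x => (S x).toReal := measurable_ereal_toReal.comp hS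
  -- On a chord `T + S` is its length, so `v` spreads the value of `k` at the exit point evenly over
  -- the chord. Disintegrating the integral of `v` from either end gives the two sides.
  set v : X → ENNReal := fun x => ENNReal.ofReal (J (T x).toReal x) * k (φ (T x).toReal x) /
    ENNReal.ofReal ((T x).toReal + (S x).toReal) with hvdef
  have hv : Measurable v :=
    (((hJ.measurable.comp (hTr.prodMk measurable_id)).ennreal_ofReal).mul
      (hk.comp ((measurable_flow φ).comp (hTr.prodMk measurable_id)))).div
      (hTr.add hSr).ennreal_ofReal
  have h1 : ∫⁻ x in traversing φ E0, v x ∂m = ∫⁻ z in finiteOut φ E0, k z ∂mp := by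
    refine hp.lintegral_traversing hE0 hB hJ hv fun z hz ℓ hℓ s hs => ?_
    have hs' : s ∈ timesBefore (tMinus φ E0 z) := by rwa [hℓ, timesBefore_coe]
    have hx := flow_neg_mem hE0 hz hs'
    have hmul : J s (φ (-s) z) * J (-s) z = 1 := by simpa using hJ.mul_neg (-s) z
    simp only [hvdef]
    rw [hTeq _ (.inl hx), hSeq' _ hx, tPlus_flow_neg hE0 hz hs', tMinus_flow_neg hE0 hz hℓ hs,
      EReal.toReal_coe, EReal.toReal_coe, flow_flow_neg, add_sub_cancel, ← mul_div_assoc,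
      ← mul_assoc, ← ENNReal.ofReal_mul (hJ.nonneg _ _), mul_comm (J (-s) z), hmul,
      ENNReal.ofReal_one, one_mul]
  have hE0r := isOpen_orbit_reverse hE0
  have h2 : ∫⁻ x in traversing φ.reverse E0, v x ∂m = ∫⁻ z in finiteOut φ.reverse E0,
      ENNReal.ofReal (J (T z).toReal z) * k (φ (T z).toReal z) ∂mm := by
    refine hn.lintegral_traversing hE0r hB.reverse hJ.reverse hv fun z hz ℓ hℓ s hs => ?_
    have hs' : s ∈ timesBefore (tMinus φ.reverse E0 z) := by rwa [hℓ, timesBefore_coe]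
    have hx := flow_neg_mem hE0r hz hs'
    have hTx := tMinus_flow_neg hE0r hz hℓ hs
    have hSx := tPlus_flow_neg hE0r hz hs'
    rw [tMinus_reverse] at hTx hℓ
    rw [tPlus_reverse] at hSx
    rw [Flow.reverse_apply, neg_neg] at hx hTx hSx ⊢
    have hTz : T z = ℓ := by rw [hTeq z (.inr hz), hℓ]
    simp only [hvdef]
    rw [hTeq _ (.inl hx), hSeq' _ hx, hTx, hSx, hTz, EReal.toReal_coe, EReal.toReal_coe,
      EReal.toReal_coe, ← φ.map_add, sub_add_cancel, ← mul_div_assoc,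
      ← mul_assoc, ← ENNReal.ofReal_mul (hJ.nonneg _ _), mul_comm (J s z), ← hJ.add,
      sub_add_cancel]
  rw [← h1, ← h2, traversing_reverse]

/-- `lintegral_finiteOut_eq` on indicators; in this form null sets, integrability and signed
integrals also pass from one boundary to the other. -/
theorem restrict_finiteOut_eq_map {mp mm : Measure X} [SFinite mp] [SFinite mm]
    (hp : Disintegrates φ E0 J m mp) (hn : Disintegrates φ.reverse E0 (fun t => J (-t)) m mm)
    (hE0 : ∀ x : X, IsOpen {t : ℝ | φ t x ∈ E0}) (hB : BorelGeometry φ E0) (hJ : IsCocycle φ J)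
    {T : X → EReal} (hT : Measurable T) (hTeq : ∀ x ∈ E0 ∪ inBd φ E0, T x = tPlus φ E0 x) :
    mp.restrict (finiteOut φ E0) =
      ((mm.restrict (finiteOut φ.reverse E0)).withDensity
        (fun z => ENNReal.ofReal (J (T z).toReal z))).map (fun z => φ (T z).toReal z) := by
  have hTr : Measurable fun x => (T x).toReal := measurable_ereal_toReal.comp hT
  have he : Measurable fun z => φ (T z).toReal z :=
    (measurable_flow φ).comp (hTr.prodMk measurable_id)
  have hd : Measurable fun z => ENNReal.ofReal (J (T z).toReal z) :=
    (hJ.measurable.comp (hTr.prodMk measurable_id)).ennreal_ofReal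
  ext A hA
  rw [Measure.map_apply he hA, withDensity_apply _ (he hA), ← lintegral_indicator_one hA,
    lintegral_finiteOut_eq hp hn hE0 hB hJ hT hTeq (measurable_one.indicator hA),
    ← lintegral_indicator (he hA)]
  refine lintegral_congr fun z => ?_
  by_cases hz : φ (T z).toReal z ∈ A <;> simp [indicator, hz]

end Chords

/-! ### Orbits that never leave `E0`. -/

section Invariant

variable {X : Type*} [TopologicalSpace X] [SecondCountableTopology X] [MeasurableSpace X]
  [BorelSpace X] {φ : Flow ℝ X} {E0 : Set X} {J : ℝ → X → ℝ} {m : Measure X} [SFinite m]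

/-- The transport operator conserves mass on the orbits that stay in `E0`. -/
theorem setIntegral_eq_zero_of_invariant (hJ : IsCocycle φ J) (hm : HasFlowDensity φ J m)
    {f g : X → ℝ} (hf : Measurable f) (hg : Measurable g) (hfi : Integrable f m)
    (hgi : Integrable g m) (hsol : ∀ᵐ y ∂m, SolvesAlong φ J E0 f g y)
    {I : Set X} (hI : MeasurableSet I) (hIE : I ⊆ E0) (hinv : ∀ t x, φ t x ∈ I ↔ x ∈ I) :
    ∫ x in I, g x ∂m = 0 := by
  set k : X → ℝ := I.indicator fun _ => 1 with hkdef
  have hk : Measurable k := measurable_const.indicator hI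
  have hk1 : ∀ x, |k x| ≤ 1 := fun x => by by_cases hx : x ∈ I <;> simp [hkdef, hx]
  have hkinv : ∀ t x, k (φ t x) = k x := fun t x => by
    by_cases hx : x ∈ I <;> simp [hkdef, hx, hinv]
  have hmul : ∀ v : X → ℝ, ∫ y in I, v y ∂m = ∫ y, v y * k y ∂m := fun v => by
    rw [← integral_indicator hI]
    refine integral_congr_ae (Eventually.of_forall fun y => ?_)
    by_cases hy : y ∈ I <;> simp [hkdef, hy]
  have h1 := hm.integral_mul_intervalIntegral hJ hg hgi hk hk1 (c := fun _ => 1) (b := 1)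
    continuous_const zero_le_one
  simp only [hkinv, one_mul, intervalIntegral.integral_const, sub_zero, one_smul] at h1
  have h2 := hm.integral_alongFlow_mul hJ (-1) hf hk
  simp only [hkinv] at h2
  -- As `k` is invariant, the integral of `g` equals that of its average over unit time, which is an
  -- increment of `f`; both terms of the increment have the same integral.
  have h3 : (fun y => (∫ r in 0..1, alongFlow φ J g y (-r)) * k y) =ᵐ[m]
      fun y => alongFlow φ J f y (-1) * k y - f y * k y := by
    filter_upwards [hsol] with y hy
    by_cases hyI : y ∈ I
    · rw [hy 1 zero_le_one fun s _ => hIE ((hinv _ y).2 hyI)]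
      ring
    · simp [hkdef, hyI]
  have hik : ∀ {v : X → ℝ}, Integrable v m → Integrable (fun y => v y * k y) m := fun hv =>
    hv.mul_bdd (c := 1) hk.aestronglyMeasurable (Eventually.of_forall hk1)
  rw [hmul, h1, integral_congr_ae h3, integral_sub (hik (hm.integrable_alongFlow hJ _ hf hfi))
    (hik hfi), h2, sub_self]

end Invariant

/-! ### Green's formula. -/

section Green

variable {X : Type*} [TopologicalSpace X] {φ : Flow ℝ X} {E0 : Set X}

theorem forall_mem_iff (hE0 : ∀ x : X, IsOpen {t : ℝ | φ t x ∈ E0}) (x : X) :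
    (∀ t, φ t x ∈ E0) ↔ x ∈ E0 \ (leaving φ E0 ∪ leaving φ.reverse E0) := by
  constructor
  · intro h
    have hx : x ∈ E0 := by simpa using h 0
    refine ⟨hx, ?_⟩
    rintro (⟨-, hlt⟩ | ⟨-, hlt⟩)
    · rw [mem_ofPred_eq, (tPlus_eq_top_iff hE0 (.inl hx)).2 fun r _ => h r] at hlt
      exact lt_irrefl _ hlt
    · rw [mem_ofPred_eq, tPlus_reverse,
        (tMinus_eq_top_iff hE0 (.inl hx)).2 fun r _ => h (-r)] at hlt
      exact lt_irrefl _ hlt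
  · rintro ⟨hx, hnot⟩ t
    have h1 : tPlus φ E0 x = ⊤ := by
      by_contra hne
      exact hnot (.inl ⟨hx, lt_top_iff_ne_top.2 hne⟩)
    have h2 : tMinus φ E0 x = ⊤ := by
      by_contra hne
      exact hnot (.inr ⟨hx, by rw [mem_ofPred_eq, tPlus_reverse]; exact lt_top_iff_ne_top.2 hne⟩)
    rcases lt_trichotomy t 0 with ht | rfl | ht
    · simpa using (tMinus_eq_top_iff hE0 (.inl hx)).1 h2 (-t) (by linarith)
    · simpa using hx
    · exact (tPlus_eq_top_iff hE0 (.inl hx)).1 h1 t ht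

theorem flow_neg_mem_leaving_reverse_iff (hE0 : ∀ x : X, IsOpen {t : ℝ | φ t x ∈ E0}) {z : X}
    (hz : z ∈ outBd φ E0) {s : ℝ} (hs : s ∈ timesBefore (tMinus φ E0 z)) :
    φ (-s) z ∈ leaving φ.reverse E0 ↔ z ∈ finiteOut φ E0 := by
  simp only [leaving, finiteOut, mem_inter_iff, mem_ofPred_eq, tPlus_reverse, lt_top_iff_ne_top,
    Ne, tMinus_flow_neg_eq_top_iff hE0 hz hs, flow_neg_mem hE0 hz hs, hz, true_and]

variable [SecondCountableTopology X] [MeasurableSpace X] [BorelSpace X]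
  {J : ℝ → X → ℝ} {m mp mm : Measure X} [SFinite mp] [SFinite mm]

/-- Whether a point of a backward orbit comes from `Γ⁻` depends only on the end point `z`, so the
indicator leaves the inner integral. -/
theorem Disintegrates.integral_leaving_diff (hp : Disintegrates φ E0 J m mp)
    (hE0 : ∀ x : X, IsOpen {t : ℝ | φ t x ∈ E0}) (hB : BorelGeometry φ E0) (hJ : IsCocycle φ J)
    {g : X → ℝ} (hg : Measurable g) (hgi : Integrable g m) :
    ∫ x in leaving φ E0 \ leaving φ.reverse E0, g x ∂m = ∫ z in (finiteOut φ E0)ᶜ,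
      (∫ s in timesBefore (tMinus φ E0 z), alongFlow φ J g z (-s)) ∂mp := by
  have hL := hB.reverse.measurableSet_leaving
  rw [sdiff_eq, ← setIntegral_indicator hL.compl, hp.integral_leaving hB hJ
    (hg.indicator hL.compl) (hgi.indicator hL.compl),
    ← integral_indicator hB.measurableSet_finiteOut.compl]
  refine integral_congr_ae ?_
  filter_upwards [hp.ae_mem] with z hz
  have hmem := fun s hs => flow_neg_mem_leaving_reverse_iff hE0 hz (s := s) hs
  by_cases hA : z ∈ finiteOut φ E0
  · rw [indicator_of_notMem (by simpa using hA)]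
    refine setIntegral_eq_zero_of_forall_eq_zero fun s hs => ?_
    rw [alongFlow, indicator_of_notMem (by simpa using (hmem s hs).2 hA), zero_mul]
  · rw [indicator_of_mem (by simpa using hA)]
    refine setIntegral_congr_fun (measurableSet_timesBefore _) fun s hs => ?_
    simp only [alongFlow]
    rw [indicator_of_mem (by simpa [hmem s hs] using hA)]

/-- Along an orbit that enters and leaves `E0`, the difference of the traces is the integral of the
source. -/
theorem ae_trace_exit_eq (hp : Disintegrates φ E0 J m mp)
    (hn : Disintegrates φ.reverse E0 (fun t => J (-t)) m mm)
    (hE0 : ∀ x : X, IsOpen {t : ℝ | φ t x ∈ E0}) (hB : BorelGeometry φ E0) (hJ : IsCocycle φ J)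
    {f g γp γm : X → ℝ} (hg : Measurable g) (hgi : Integrable g m)
    (hsolr : ∀ᵐ y ∂m, SolvesAlong φ.reverse (fun t => J (-t)) E0 f (fun x => -g x) y)
    (hγp : ∀ᵐ z ∂mp, Tendsto (fun s => alongFlow φ J f z (-s)) (𝓝[>] 0) (𝓝 (γp z)))
    (hγm : ∀ᵐ z ∂mm, Tendsto (fun s => alongFlow φ.reverse (fun t => J (-t)) f z (-s))
      (𝓝[>] 0) (𝓝 (γm z)))
    {T : X → EReal} (hT : Measurable T) (hTeq : ∀ x ∈ E0 ∪ inBd φ E0, T x = tPlus φ E0 x) :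
    ∀ᵐ z ∂mm, z ∈ finiteOut φ.reverse E0 → γp (φ (T z).toReal z) * J (T z).toReal z =
      γm z - ∫ s in timesBefore (tMinus φ.reverse E0 z),
        alongFlow φ.reverse (fun t => J (-t)) g z (-s) := by
  have hE0r := isOpen_orbit_reverse hE0
  have hA' := hB.reverse.measurableSet_finiteOut
  have hTr : Measurable fun x => (T x).toReal := measurable_ereal_toReal.comp hT
  have hd : Measurable fun z => ENNReal.ofReal (J (T z).toReal z) :=
    (hJ.measurable.comp (hTr.prodMk measurable_id)).ennreal_ofReal
  have h1 := ae_restrict_of_ae (s := finiteOut φ E0) hγp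
  -- The trace on `Γ⁺` exists `mp`-almost everywhere; since the density `J` is positive, it exists
  -- at the exit point of `mm`-almost every chord.
  rw [restrict_finiteOut_eq_map hp hn hE0 hB hJ hT hTeq] at h1
  have h2 := ae_of_ae_map
    ((measurable_flow φ).comp (hTr.prodMk measurable_id)).aemeasurable h1
  rw [ae_withDensity_iff hd, ae_restrict_iff' hA'] at h2
  filter_upwards [h2, hn.ae_integrableOn hB.reverse hJ.reverse hg hgi,
    hn.ae_eq_trace_add_integral (g := fun x => -g x) hE0r hB.reverse hJ.reverse hg.neg hgi.neg
      hsolr hγm]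
    with z hz2 hgz hz hfin
  obtain ⟨ℓ, hℓ0, hℓ⟩ := exists_coe_eq_tMinus hE0r hfin
  have hTz : T z = ℓ := by
    rw [hTeq z (.inr hfin.1), ← hℓ, tMinus_reverse]
  have hlim1 : Tendsto (fun s => alongFlow φ J f (φ (T z).toReal z) (-s)) (𝓝[>] 0)
      (𝓝 (γp (φ (T z).toReal z))) := hz2 hfin (by simpa using hJ.pos _ _)
  rw [hℓ, timesBefore_coe] at hgz hz ⊢
  simp only [hTz, EReal.toReal_coe] at hlim1 ⊢
  have hlim2 := hlim1.mul_const (J ℓ z)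
  simp only [alongFlow_flow_mul hJ] at hlim2
  set q : ℝ → ℝ := fun r => alongFlow φ.reverse (fun t => J (-t)) g z (-r) with hq
  have hqi : IntervalIntegrable q volume 0 ℓ :=
    (intervalIntegrable_iff_integrableOn_Ioo_of_le hℓ0.le).2 hgz
  have hc : ContinuousOn (fun u => ∫ r in 0..u, q r) (uIcc 0 ℓ) :=
    intervalIntegral.continuousOn_primitive_interval' hqi left_mem_uIcc
  have hsub : Tendsto (fun s : ℝ => ℓ - s) (𝓝[>] 0) (𝓝[uIcc 0 ℓ] ℓ) := by
    refine tendsto_nhdsWithin_iff.2 ⟨?_, ?_⟩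
    · have : Tendsto (fun s : ℝ => ℓ - s) (𝓝 0) (𝓝 (ℓ - 0)) :=
        tendsto_const_nhds.sub tendsto_id
      rw [sub_zero] at this
      exact this.mono_left nhdsWithin_le_nhds
    · filter_upwards [Ioo_mem_nhdsGT hℓ0] with s hs
      rw [uIcc_of_le hℓ0.le]
      exact ⟨by linarith [hs.2], by linarith [hs.1]⟩
  have hlim3 : Tendsto (fun s => γm z - ∫ r in 0..(ℓ - s), q r) (𝓝[>] 0)
      (𝓝 (γm z - ∫ r in 0..ℓ, q r)) :=
    (Tendsto.comp (hc ℓ right_mem_uIcc) hsub).const_sub (γm z)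
  rw [← integral_Ioc_eq_integral_Ioo, ← intervalIntegral.integral_of_le hℓ0.le]
  -- The same values near the exit are computed twice: as the trace on `Γ⁺` times `J ℓ z`, and by
  -- the equation started on `Γ⁻`.
  refine tendsto_nhds_unique hlim2 (hlim3.congr' ?_)
  filter_upwards [Ioo_mem_nhdsGT hℓ0] with s hs
  have := hz (ℓ - s) ⟨by linarith [hs.2], by linarith [hs.1]⟩
  rw [alongFlow_reverse, neg_neg] at this
  rw [neg_add_eq_sub, this]
  simp only [alongFlow_neg, intervalIntegral.integral_neg, hq]
  rw [sub_eq_add_neg]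

/-- **Green's formula** for the solutions of the transport equation. -/
theorem integrable_trace_and_integral_eq [SFinite m] (hp : Disintegrates φ E0 J m mp)
    (hn : Disintegrates φ.reverse E0 (fun t => J (-t)) m mm)
    (hE0 : ∀ x : X, IsOpen {t : ℝ | φ t x ∈ E0}) (hB : BorelGeometry φ E0) (hJ : IsCocycle φ J)
    (hm : HasFlowDensity φ J m) {f g γp γm : X → ℝ} (hf : Measurable f) (hg : Measurable g)
    (hfi : Integrable f m) (hgi : Integrable g m) (hsol : ∀ᵐ y ∂m, SolvesAlong φ J E0 f g y)
    (hγp : ∀ᵐ z ∂mp, Tendsto (fun s => alongFlow φ J f z (-s)) (𝓝[>] 0) (𝓝 (γp z)))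
    (hγm : ∀ᵐ z ∂mm, Tendsto (fun s => alongFlow φ.reverse (fun t => J (-t)) f z (-s))
      (𝓝[>] 0) (𝓝 (γm z)))
    (hγmi : Integrable γm mm) :
    Integrable γp mp ∧ ∫ x in E0, g x ∂m = (∫ z, γm z ∂mm) - ∫ z, γp z ∂mp := by
  have hE0r := isOpen_orbit_reverse hE0
  have hsolr := ae_solvesAlong_reverse hE0 hJ hm hg hgi hsol
  obtain ⟨T, hT, hTeq⟩ := hB.exists_measurable_tPlus
  have hTr : Measurable fun x => (T x).toReal := measurable_ereal_toReal.comp hT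
  have he : Measurable fun z => φ (T z).toReal z :=
    (measurable_flow φ).comp (hTr.prodMk measurable_id)
  have hd : Measurable fun z => ENNReal.ofReal (J (T z).toReal z) :=
    (hJ.measurable.comp (hTr.prodMk measurable_id)).ennreal_ofReal
  set A := finiteOut φ E0
  set A' := finiteOut φ.reverse E0
  have hA : MeasurableSet A := hB.measurableSet_finiteOut
  have hA' : MeasurableSet A' := hB.reverse.measurableSet_finiteOut
  set Gp : X → ℝ := fun z => ∫ s in timesBefore (tMinus φ E0 z), alongFlow φ J g z (-s)
  set Gm : X → ℝ := fun z => ∫ s in timesBefore (tMinus φ.reverse E0 z),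
    alongFlow φ.reverse (fun t => J (-t)) g z (-s)
  have hGp : Integrable Gp mp := hp.integrable_integral hB hJ hg hgi
  have hGm : Integrable Gm mm := hn.integrable_integral hB.reverse hJ.reverse hg hgi
  have htop : ∀ᵐ z ∂mp.restrict Aᶜ, -Gp z = γp z := by
    rw [ae_restrict_iff' hA.compl]
    filter_upwards [hp.ae_mem, hp.ae_trace_eq_neg_integral hE0 hB hJ hf hg hfi hgi hsol hγp]
      with z hz hγ hzA
    refine (hγ ?_).symm
    by_contra hne
    exact hzA ⟨hz, lt_top_iff_ne_top.2 hne⟩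
  have htop' : ∀ᵐ z ∂mm.restrict A'ᶜ, Gm z = γm z := by
    rw [ae_restrict_iff' hA'.compl]
    filter_upwards [hn.ae_mem, hn.ae_trace_eq_neg_integral (g := fun x => -g x) hE0r hB.reverse
      hJ.reverse hf hg.neg hfi hgi.neg hsolr hγm] with z hz hγ hzA
    rw [hγ (by by_contra hne; exact hzA ⟨hz, lt_top_iff_ne_top.2 hne⟩)]
    simp only [alongFlow_neg, integral_neg, neg_neg, Gm]
  have hexit : ∀ᵐ z ∂mm.restrict A', γm z - Gm z =
      γp (φ (T z).toReal z) * J (T z).toReal z := by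
    rw [ae_restrict_iff' hA']
    filter_upwards [ae_trace_exit_eq hp hn hE0 hB hJ hg hgi hsolr hγp hγm hT hTeq]
      with z hz hzA using (hz hzA).symm
  have hmap := restrict_finiteOut_eq_map hp hn hE0 hB hJ hT hTeq
  have hmeas : AEStronglyMeasurable γp (mp.restrict A) :=
    (Disintegrates.aestronglyMeasurable_trace hJ hf hγp).restrict
  have htoReal : ∀ z, (ENNReal.ofReal (J (T z).toReal z)).toReal = J (T z).toReal z :=
    fun z => ENNReal.toReal_ofReal (hJ.nonneg _ _)
  have hiA : IntegrableOn γp A mp := by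
    rw [IntegrableOn, hmap]
    rw [hmap] at hmeas
    rw [integrable_map_measure hmeas he.aemeasurable, integrable_withDensity_iff hd (by simp)]
    refine ((hγmi.sub hGm).restrict (s := A')).congr ?_
    filter_upwards [hexit] with z hz
    simpa [htoReal] using hz
  have hintA : ∫ z in A, γp z ∂mp = ∫ z in A', γm z ∂mm - ∫ z in A', Gm z ∂mm := by
    rw [hmap] at hmeas
    rw [hmap, integral_map he.aemeasurable hmeas,
      integral_withDensity_eq_integral_toReal_smul hd (by simp),
      ← integral_sub hγmi.integrableOn hGm.integrableOn]
    refine integral_congr_ae ?_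
    filter_upwards [hexit] with z hz
    rw [hz, htoReal, smul_eq_mul, mul_comm]
  have hiAc : IntegrableOn γp Aᶜ mp := (hGp.neg.restrict (s := Aᶜ)).congr htop
  have hi : Integrable γp mp := by
    rw [← integrableOn_univ, ← union_compl_self A]
    exact hiA.union hiAc
  refine ⟨hi, ?_⟩
  have hL := hB.measurableSet_leaving
  have hLr := hB.reverse.measurableSet_leaving
  set L := leaving φ E0
  set L' := leaving φ.reverse E0
  have hI : MeasurableSet (E0 \ (L ∪ L')) := hB.measurableSet_E0.diff (hL.union hLr)
  have hinv : ∫ x in E0 \ (L ∪ L'), g x ∂m = 0 := by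
    refine setIntegral_eq_zero_of_invariant hJ hm hf hg hfi hgi hsol hI sdiff_subset
      fun t x => ?_
    rw [← forall_mem_iff hE0, ← forall_mem_iff hE0]
    refine ⟨fun h s => ?_, fun h s => ?_⟩
    · simpa [← φ.map_add] using h (s - t)
    · rw [← φ.map_add]; exact h _
  -- `L'` consists of the points coming from `Γ⁻`, chords included, and is integrated from `Γ⁻`; `L
  -- \ L'` is integrated from `Γ⁺`; the rest is invariant.
  have hdecomp : E0 = L' ∪ ((L \ L') ∪ (E0 \ (L ∪ L'))) := by
    have h1 : L ⊆ E0 := inter_subset_left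
    have h2 : L' ⊆ E0 := inter_subset_left
    ext x
    have := @h1 x
    have := @h2 x
    simp only [mem_union, Set.mem_sdiff]
    tauto
  have hsplit : ∫ x in E0, g x ∂m = ∫ z, Gm z ∂mm + ∫ z in Aᶜ, Gp z ∂mp := by
    conv_lhs => rw [hdecomp]
    rw [setIntegral_union ?_ ((hL.diff hLr).union hI) hgi.integrableOn hgi.integrableOn,
      setIntegral_union ?_ hI hgi.integrableOn hgi.integrableOn, hinv, add_zero,
      hp.integral_leaving_diff hE0 hB hJ hg hgi,
      hn.integral_leaving hB.reverse hJ.reverse hg hgi]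
    · exact disjoint_left.2 fun x h1 h2 => h2.2 (.inl h1.1)
    · exact disjoint_left.2 fun x h1 h2 => h2.elim (fun h => h.2 h1) fun h => h.2 (.inr h1)
  -- The term `∫_{A'} Gm` is `∫_{A'} γm - ∫_A γp` by `hintA`; off `A'` and `A` the integrals are
  -- those of `γm` and of `-γp`, and the pieces add up.
  have h1 := integral_add_compl hA' hGm
  have h2 := integral_add_compl hA' hγmi
  have h3 := integral_add_compl hA hi
  have h4 := integral_congr_ae htop
  have h5 := integral_congr_ae htop'
  rw [integral_neg] at h4
  linarith

end Green

end FlowTransport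

/-! ### The theorem. -/

theorem theorem2p2 {X : Type*} [MetricSpace X] [TopologicalSpace.SeparableSpace X]
    [MeasurableSpace X] [BorelSpace X]
    (φ : Flow ℝ X) (E0 : Set X)
    (hE0 : ∀ x : X, IsOpen {t : ℝ | φ t x ∈ E0})
    (hBorel : BorelGeometry φ E0)
    (J : ℝ → X → ℝ) (hJ : IsCocycle φ J)
    (m : Measure X) [SigmaFinite m] [IsLocallyFiniteMeasure m] [m.InnerRegular]
    (hfr : m (frontier (stateSp φ E0)) = 0)
    (hm : HasFlowDensity φ J m)
    (mp mm : Measure X) [IsFiniteMeasure mp] [IsFiniteMeasure mm]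
    (hmp : IsOutMeasure φ E0 J m mp) (hmm : IsInMeasure φ E0 J m mm)
    (f Tf : X → ℝ) (hf : IsTmax φ E0 m f Tf) :
    (∃ γm : X → ℝ, IsInTrace φ E0 J m mm f γm) ∧
    (∃ γp : X → ℝ, IsOutTrace φ E0 J m mp f γp) ∧
    ∀ γm γp : X → ℝ, IsInTrace φ E0 J m mm f γm → IsOutTrace φ E0 J m mp f γp →
      Integrable γm mm →
        Integrable γp mp ∧
        ∫ x in stateSp φ E0, Tf x ∂m = (∫ z, γm z ∂mm) - (∫ z, γp z ∂mp) := by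
  have : SecondCountableTopology X := UniformSpace.secondCountable_of_separable X
  have hE := hm.stateSp_ae_eq hBorel.measurableSet_inBd
  have hrestr : m.restrict (stateSp φ E0) = m.restrict E0 := Measure.restrict_congr_set hE
  have hE0m := hBorel.measurableSet_E0
  -- Borel versions on the whole space, zero almost everywhere off `E0`, are needed for composition
  -- with the flow and for Fubini.
  have hversion : ∀ {u : X → ℝ}, IntegrableOn u (stateSp φ E0) m →
      ∃ v : X → ℝ, Measurable v ∧ Integrable v m ∧ (∀ᵐ x ∂m, v x = E0.indicator u x) := by
    intro u hu
    rw [IntegrableOn, hrestr] at hu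
    have hi : Integrable (E0.indicator u) m := (integrable_indicator_iff hE0m).2 hu
    obtain ⟨v, hv, hvu⟩ := hi.aestronglyMeasurable
    exact ⟨v, hv.measurable, hi.congr hvu, hvu.symm⟩
  obtain ⟨f₁, hf₁m, hf₁i, hf₁⟩ := hversion hf.integrable_left
  obtain ⟨g, hgm, hgi, hg⟩ := hversion hf.integrable_right
  have hset : ∀ {u v w : X → ℝ}, (∀ᵐ x ∂m, v x = E0.indicator u x) →
      ∫ x in stateSp φ E0, u x * w x ∂m = ∫ x, v x * w x ∂m := by
    intro u v w huv
    rw [hrestr, ← integral_indicator hE0m]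
    refine integral_congr_ae ?_
    filter_upwards [huv] with x hx
    rw [hx, indicator_mul_left]
  have hweak : ∀ ψ, IsTestFun φ E0 ψ → ∫ x, g x * ψ x ∂m = ∫ x, f₁ x * flowDeriv φ ψ x ∂m :=
    fun ψ hψ => by rw [← hset hg, ← hset hf₁, hf.weak ψ hψ]
  set f₀ := regularize φ J f₁
  have hf₀m : Measurable f₀ := measurable_regularize hJ hf₁m
  have hf₀ : f₀ =ᵐ[m] f₁ := hm.regularize_ae_eq hJ hf₁m hf₁i
  have hf₀i : Integrable f₀ m := hf₁i.congr hf₀.symm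
  have hsol := ae_solvesAlong_regularize hE0 hBorel hJ hm hf₁m hgm hf₁i hgi hweak
  have hsolr := ae_solvesAlong_reverse hE0 hJ hm hgm hgi hsol
  have hE0r := isOpen_orbit_reverse hE0
  have hp := hmp.disintegrates hE0 hBorel hJ
  have hn := hmm.disintegrates hE0 hBorel hJ
  have hexp := hp.ae_exists_tendsto hE0 hBorel hJ hgm hgi hsol
  have hexm := hn.ae_exists_tendsto hE0r hBorel.reverse hJ.reverse hgm.neg hgi.neg hsolr
  have hf₀f : ∀ᵐ x ∂m, x ∈ E0 → f₀ x = f x := by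
    filter_upwards [hf₀, hf₁] with x h1 h2 hx
    rw [h1, h2, indicator_of_mem hx]
  have hf₀f' : f₀ =ᵐ[m.restrict (stateSp φ E0)] f := by
    rw [hrestr]
    exact (ae_restrict_iff' hE0m).2 hf₀f
  have hrep : ∀ {f' : X → ℝ}, f' =ᵐ[m.restrict (stateSp φ E0)] f →
      ∀ᵐ x ∂m, x ∈ E0 → f' x = f₀ x := by
    intro f' hf'
    rw [hrestr] at hf'
    filter_upwards [(ae_restrict_iff' hE0m).1 hf', hf₀f] with x h1 h2 hx
    rw [h1 hx, h2 hx]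
  have hback : ∀ (u : X → ℝ) (z : X),
      (fun s : ℝ => alongFlow φ.reverse (fun t => J (-t)) u z (-s)) =
        fun s => u (φ s z) * J s z := fun u z => by
    funext s
    simp [alongFlow]
  refine ⟨⟨fun z => limUnder (𝓝[>] 0) fun s => f₀ (φ s z) * J s z, f₀, hf₀f',
      hexm.mono fun z hz => ?_⟩,
    ⟨fun z => limUnder (𝓝[>] 0) fun s => f₀ (φ (-s) z) * J (-s) z, f₀, hf₀f',
      hexp.mono fun z hz => tendsto_nhds_limUnder hz⟩, ?_⟩
  · rw [hback] at hz
    exact tendsto_nhds_limUnder hz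
  -- The two given traces may come from different representatives of `f`; both are first carried
  -- over to `f₀`.
  · rintro γm γp ⟨fm, hfm, hγm⟩ ⟨fp, hfp, hγp⟩ hγmi
    have hγp' := hp.ae_tendsto_of_ae_eq hE0 hBorel hJ (hrep hfp) hexp hγp
    have hγm' := hn.ae_tendsto_of_ae_eq hE0r hBorel.reverse hJ.reverse (hrep hfm) hexm
      (by simpa only [hback] using hγm)
    have hgreen := integrable_trace_and_integral_eq hp hn hE0 hBorel hJ hm hf₀m hgm hf₀i hgi hsol
      hγp' hγm' hγmi
    refine ⟨hgreen.1, ?_⟩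
    rw [← hgreen.2, hrestr]
    refine setIntegral_congr_ae hE0m ?_
    filter_upwards [hg] with x hx hxE
    rw [hx, indicator_of_mem hxE]
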